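/- All directed graphs are finite and simple (no loops, no multiple arcs). A flow graph $(G,s)$ is a directed graph $G=(V,E)$ with a vertex $s$ from which every vertex is reachable. A depth-first search from $s$ yields a depth-first spanning tree $T$ and a preorder numbering $po$. Write $v\xrightarrow{*}w$ if $T$ contains a (possibly trivial) directed path from $v$ to $w$. An arc $vw$ is a tree arc if $vw\in E(T)$; a forward arc if $vw\notin E(T)$ and $v\xrightarrow{*}w$; a cycle arc if $w\xrightarrow{*}v$; a cross arc if neither $v\xrightarrow{*}w$ nor $w\xrightarrow{*}v$ holds and $po(w)<po(v)$. The flow graph $(G,s)$ is reducible if the set of its tree, forward and cross arcs is the same for all depth-first spanning trees rooted at $s$. An LR-order of $G$ is a linear order of $V$ in which each vertex has all its successors before it (a left vertex) or all its successors after it (a right vertex). A feedback vertex set is a set $S\subsetneq V$ that meets every directed cycle; it is acyclic if $G[S]$ has no directed cycle. Algorithm Reducibility on $(G,s,T)$. A head is a vertex $w\ne s$ entered by a cycle arc. Treat the heads $w_1,\dots,w_k$ in order of decreasing $po$. For $w=w_i$, let $P^*(w)$ be the set of vertices $v$ of the current graph from which a path avoiding $w$ leads to some $z$ such that $zw$ is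 a cycle arc of the current graph; answer "No" if some $v\in P^*(w)$ does not satisfy $w\xrightarrow{*}v$; then collapse $P^*(w)$ into $w$, i.e. merge $P^*(w)$ with $w$ and remove loops and redundant arcs. If all tests succeed, let $P^*(s)$ be the set of the vertices $v\neq s$ that lie in no $P^*(w_i)$, and answer "Yes". Algorithm LR-ordering on $(G,s,T)$. Apply Reducibility and let $W=\{w_1,\dots,w_k,s\}$. Let $B$ be the undirected graph whose vertices (boxes) are the sets $\{w\}$ and the non-empty sets $P^*(w)\setminus W$, for $w\in W$, and whose edges join $\{w\}$ to $P^*(w)\setminus W$ (if non-empty) and to $\{w'\}$ for each $w'\in W\cap P^*(w)$. Choose a partition $(R',L')$ of the boxes with no edge of $B$ inside $R'$ or inside $L'$; let $R$ and $L$ be the unions of the boxes in $R'$ and in $L'$. Return the sequence $U$ formed by a topological order of $G[R]$ followed by a reversed topological order of $G[L]$. Theorem. 1. Let $(G,s)$ be a reducible flow graph and $T$ any depth-first spanning tree of it rooted at $s$. Then Algorithm LR-ordering succeeds on $(G,s,T)$, and whatever choices it makes, $V$ is the disjoint union of $R$ and $L$, the returned sequence $U$ is an LR-order of $G$ in which the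 vertices of $R$ are right vertices and precede the vertices of $L$, which are left vertices, and both $G[R]$ and $G[L]$ are acyclic. If $|V|\ge 2$, both $R$ and $L$ are acyclic feedback vertex sets. 2. Hence every reducible flow graph has an acyclic feedback vertex set $S$ (so $V$ splits into the two parts $S$ and $V\setminus S$, each inducing an acyclic graph). 3. The algorithm runs in polynomial time. Precisely, there are one program for a random access machine (with variables, two-dimensional arrays, successor as its only arithmetic operation, tests, bounded loops, and unit cost for each operation) and one polynomial $p$ such that, for every reducible flow graph $(G,s)$ with vertex set $\{0,\dots,n-1\}$, given by $n$, $s$ and its adjacency matrix, the program stops after at most $p(n)$ steps and outputs, for each $v\ne s$, the vertex $w\in W$ with $v\in P^*(w)$, the set $R$, and the sequence $U$. These are results of Algorithm LR-ordering on $(G,s,T)$ for every depth-first spanning tree $T$ rooted at $s$; in particular, $U$ is an LR-order of $G$, and moreover $R$ is an acyclic feedback vertex set of $G$ with $G[V\setminus R]$ acyclic. -/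

import Mathlib

/-! ### Cycles, feedback vertex sets, LR-orders

A directed graph on the vertex type `V` is a `Digraph V` (so there are no multiple arcs).  -/

namespace Digraph

/-- No loops. -/
def IsSimple {V : Type*} (G : Digraph V) : Prop :=
  ∀ v, ¬ G.Adj v v

/-- A (directed) cycle of `G`, as a cyclic sequence of distinct vertices. -/
def IsDirCycle {V : Type*} (G : Digraph V) (c : Cycle V) : Prop :=
  c ≠ Cycle.nil ∧ c.Nodup ∧ c.Chain G.Adj

/-- The induced subgraph `G[S]` is acyclic: no cycle of `G` has all its vertices in `S`. -/
def AcyclicOn {V : Type*} (G : Digraph V) (S : Set V) : Prop :=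
  ∀ c : Cycle V, G.IsDirCycle c → ¬ ∀ v ∈ c, v ∈ S

/-- A feedback vertex set: a proper subset of the vertices that meets every cycle. -/
def IsFVS {V : Type*} (G : Digraph V) (S : Set V) : Prop :=
  S ≠ Set.univ ∧ ∀ c : Cycle V, G.IsDirCycle c → ∃ v ∈ c, v ∈ S

/-- An acyclic feedback vertex set: a feedback vertex set `S` with `G[S]` acyclic. -/
def IsAcyclicFVS {V : Type*} (G : Digraph V) (S : Set V) : Prop :=
  G.IsFVS S ∧ G.AcyclicOn S

/-- `x` stands before `y` in the sequence `l`. -/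
def Before {V : Type*} [DecidableEq V] (l : List V) (x y : V) : Prop :=
  l.idxOf x < l.idxOf y

/-- `l` lists every vertex exactly once, i.e. it is a linear order of the vertices. -/
def IsVertexOrder {V : Type*} (l : List V) : Prop :=
  l.Nodup ∧ ∀ v, v ∈ l

/-- All the successors of `v` are before `v`. -/
def IsLeftVertex {V : Type*} [DecidableEq V] (G : Digraph V) (l : List V) (v : V) : Prop :=
  ∀ w, G.Adj v w → Before l w v

/-- All the successors of `v` are after `v`. -/
def IsRightVertex {V : Type*} [DecidableEq V] (G : Digraph V) (l : List V) (v : V) : Prop :=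
  ∀ w, G.Adj v w → Before l v w

/-- An LR-order: a linear order in which every vertex is a left vertex or a right vertex. -/
def IsLROrder {V : Type*} [DecidableEq V] (G : Digraph V) (l : List V) : Prop :=
  IsVertexOrder l ∧ ∀ v, G.IsLeftVertex l v ∨ G.IsRightVertex l v

/-- A standard LR-order with parts `R` and `L`: a linear order with `V = R ⊔ L` in which the
elements of `R` are right vertices, those of `L` are left vertices, and all of `R` precedes
all of `L`. -/
def IsStandardLROrder {V : Type*} [DecidableEq V] (G : Digraph V) (R L : Set V)
    (l : List V) : Prop :=
  IsVertexOrder l ∧ IsCompl R L ∧ (∀ v ∈ R, G.IsRightVertex l v) ∧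
    (∀ v ∈ L, G.IsLeftVertex l v) ∧ ∀ v ∈ R, ∀ w ∈ L, Before l v w

/-- `l` is a topological order of the induced subgraph `G[S]`. -/
def IsTopOrder {V : Type*} [DecidableEq V] (G : Digraph V) (S : Set V) (l : List V) : Prop :=
  l.Nodup ∧ (∀ v, v ∈ l ↔ v ∈ S) ∧ ∀ x ∈ S, ∀ y ∈ S, G.Adj x y → Before l x y

/-! ### Depth-first search, flow graphs, reducibility -/

/-- A state of a depth-first search: the vertices visited so far, in order of visit; the stack
of the vertices that are still being explored (current vertex first); the tree arcs so far. -/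
structure DFSState (V : Type*) where
  visited : List V
  stack : List V
  tree : V → V → Prop

/-- One step of a depth-first search: visit some unvisited successor `w` of the current vertex
`v` along the new tree arc `vw`, or leave `v` when all its successors have been visited. -/
inductive DFSStep {V : Type*} (G : Digraph V) : DFSState V → DFSState V → Prop
  | descend (vis st : List V) (t : V → V → Prop) (v w : V) (hvw : G.Adj v w) (hw : w ∉ vis) :
      DFSStep G ⟨vis, v :: st, t⟩
        ⟨vis ++ [w], w :: v :: st, fun a b => t a b ∨ (a = v ∧ b = w)⟩
  | backtrack (vis st : List V) (t : V → V → Prop) (v : V) (hv : ∀ w, G.Adj v w → w ∈ vis) :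
      DFSStep G ⟨vis, v :: st, t⟩ ⟨vis, st, t⟩

/-- The result of a complete depth-first search of `G` from `s`: a depth-first spanning tree,
together with the order in which the vertices were visited. -/
structure DFST {V : Type*} (G : Digraph V) (s : V) where
  visited : List V
  tree : V → V → Prop
  run : Relation.ReflTransGen (DFSStep G) ⟨[s], [s], fun _ _ => False⟩ ⟨visited, [], tree⟩

namespace DFST

variable {V : Type*} {G : Digraph V} {s : V}

/-- The preorder number; `po s = 1`. -/
def po [DecidableEq V] (T : DFST G s) (v : V) : ℕ :=
  T.visited.idxOf v + 1

/-- There is a (possibly trivial) directed path in `T` from `v` to `w`. -/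
def Anc (T : DFST G s) (v w : V) : Prop :=
  Relation.ReflTransGen T.tree v w

def TreeArc (T : DFST G s) (v w : V) : Prop :=
  G.Adj v w ∧ T.tree v w

def ForwardArc (T : DFST G s) (v w : V) : Prop :=
  G.Adj v w ∧ ¬ T.tree v w ∧ T.Anc v w

def CycleArc (T : DFST G s) (v w : V) : Prop :=
  G.Adj v w ∧ T.Anc w v

def CrossArc [DecidableEq V] (T : DFST G s) (v w : V) : Prop :=
  G.Adj v w ∧ ¬ T.Anc v w ∧ ¬ T.Anc w v ∧ T.po w < T.po v

/-- The arcs of the subgraph formed by the tree, forward and cross arcs. -/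
def DagArc [DecidableEq V] (T : DFST G s) (v w : V) : Prop :=
  T.TreeArc v w ∨ T.ForwardArc v w ∨ T.CrossArc v w

end DFST

/-- `(G, s)` is a flow graph: `G` is simple and every vertex is reachable from `s`. -/
def IsFlowGraph {V : Type*} (G : Digraph V) (s : V) : Prop :=
  G.IsSimple ∧ ∀ v, Relation.ReflTransGen G.Adj s v

/-- `(G, s)` is a reducible flow graph: the tree, forward and cross arcs form the same set of
arcs for all depth-first spanning trees rooted at `s`. -/
def IsReducible {V : Type*} [DecidableEq V] (G : Digraph V) (s : V) : Prop :=
  G.IsFlowGraph s ∧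
    ∀ (T T' : DFST G s) (v w : V), T.DagArc v w ↔ T'.DagArc v w

/-! ### The algorithm Reducibility: heads, the sets `P*(w)` -/

open Classical in
/-- Collapse the set `S` into `w`: the vertices of `S` are merged with `w`, and loops and
redundant arcs are removed.  The collapsed vertices are kept in the type `V` as isolated
vertices. -/
noncomputable def collapse {V : Type*} (H : Digraph V) (S : Set V) (w : V) : Digraph V where
  Adj a b := a ≠ b ∧ ∃ a' b', H.Adj a' b' ∧
    (if a' ∈ S then w else a') = a ∧ (if b' ∈ S then w else b') = b

/-- The set `P(w)` in the current graph `H`, relative to the ancestor relation `anc` of the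
spanning tree: the vertices `v` with a path of `H` that avoids `w` and leads from `v` to some
`z` for which `zw` is a cycle arc of `H`. -/
def pathSet {V : Type*} (anc : V → V → Prop) (H : Digraph V) (w : V) : Set V :=
  {v | v ≠ w ∧ ∃ z, H.Adj z w ∧ anc w z ∧
    Relation.ReflTransGen (fun a b => H.Adj a b ∧ a ≠ w ∧ b ≠ w) v z}

open Classical in
/-- The main loop of the algorithm.  The heads in the list are treated one after the other: for
each head `w`, the set `P*(w)` is the set `P(w)` of the current graph, and is then collapsed
into `w`.  The value is the function `w ↦ P*(w)` (empty outside the list). -/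
noncomputable def collapseLoop {V : Type*} (anc : V → V → Prop) :
    Digraph V → List V → V → Set V
  | _, [] => fun _ => ∅
  | H, w :: ws => fun x =>
      if x = w then pathSet anc H w
      else collapseLoop anc (H.collapse (pathSet anc H w) w) ws x

namespace DFST

variable {V : Type*} {G : Digraph V} {s : V}

/-- `w ≠ s` is a head if some cycle arc enters `w`. -/
def IsHead (T : DFST G s) (w : V) : Prop :=
  w ≠ s ∧ ∃ v, T.CycleArc v w

open Classical in
/-- The heads `w₁, …, w_k`, by decreasing preorder number. -/
noncomputable def heads (T : DFST G s) : List V :=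
  T.visited.reverse.filter (fun w => decide (T.IsHead w))

open Classical in
/-- The sets `P*(w)`, for `w` a head or `w = s`.  Here `P*(s)` consists of the vertices `v ≠ s`
that are in no `P*(w)` for a head `w`. -/
noncomputable def pStar (T : DFST G s) (w : V) : Set V :=
  if w = s then {v | v ≠ s ∧ ∀ u ∈ T.heads, v ∉ collapseLoop T.Anc G T.heads u}
  else collapseLoop T.Anc G T.heads w

/-- The algorithm Reducibility answers "Yes": all its tests `w →* v`, for `w` a head and
`v ∈ P*(w)`, succeed. -/
def AnswersYes (T : DFST G s) : Prop :=
  ∀ w ∈ T.heads, ∀ v ∈ T.pStar w, T.Anc w v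

/-! ### The algorithm LR-ordering -/

/-- `W = {w₁, …, w_k, s}`. -/
def W (T : DFST G s) : Set V :=
  {w | w ∈ T.heads ∨ w = s}

/-- The set `V'` of boxes: the singletons `{w}` and the non-empty sets `P*(w) \ W`, `w ∈ W`. -/
def boxes (T : DFST G s) : Set (Set V) :=
  {X | ∃ w ∈ T.W, X = {w} ∨ (X = T.pStar w \ T.W ∧ X.Nonempty)}

/-- The edges of the undirected graph `B` on the boxes (each listed in one direction): from
`{w}` to `P*(w) \ W` (if non-empty), and from `{w}` to `{w'}` for `w' ∈ W ∩ P*(w)`. -/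
def BoxEdge (T : DFST G s) (X Y : Set V) : Prop :=
  ∃ w ∈ T.W, X = {w} ∧
    ((Y = T.pStar w \ T.W ∧ Y.Nonempty) ∨ ∃ w' ∈ T.W ∩ T.pStar w, Y = {w'})

/-- `(R, L, U)` is a possible result of the algorithm LR-ordering on `(G, s, T)`; the algorithm
is free to choose the partition `(R', L')` of the boxes and the two topological orders. -/
def LROutput [DecidableEq V] (T : DFST G s) (R L : Set V) (U : List V) : Prop :=
  T.AnswersYes ∧
  ∃ R' L' : Set (Set V),
    R' ∪ L' = T.boxes ∧ Disjoint R' L' ∧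
    (∀ X ∈ R', ∀ Y ∈ R', ¬ T.BoxEdge X Y) ∧
    (∀ X ∈ L', ∀ Y ∈ L', ¬ T.BoxEdge X Y) ∧
    R = {x | ∃ X ∈ R', x ∈ X} ∧
    L = {x | ∃ X ∈ L', x ∈ X} ∧
    ∃ Rtop Ltop : List V,
      G.IsTopOrder R Rtop ∧ G.IsTopOrder L Ltop ∧ U = Rtop ++ Ltop.reverse

end DFST

end Digraph

/-! ### A machine model with a step count

Programs for a random access machine with variables and two-dimensional arrays that hold natural
numbers.  The only arithmetic operation is the successor, so no number ever exceeds the largest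
number of the input by more than the number of steps; hence polynomial time on this machine is
polynomial time in the usual sense. -/

namespace Ram

/-- The memory: variables `x₀, x₁, …` and arrays `A₀, A₁, …` with entries `A_a[i, j]`. -/
structure State where
  var : ℕ → ℕ
  arr : ℕ → ℕ → ℕ → ℕ

def State.setVar (σ : State) (x val : ℕ) : State :=
  { σ with var := fun y => if y = x then val else σ.var y }

def State.setArr (σ : State) (a i j val : ℕ) : State :=
  { σ with arr := fun b k l => if b = a ∧ k = i ∧ l = j then val else σ.arr b k l }

/-- Commands.  All arguments but `c`, `d` are names of variables or of arrays. -/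
inductive Cmd where
  /-- do nothing -/
  | skip
  /-- `x := 0` -/
  | zero (x : ℕ)
  /-- `x := y` -/
  | copy (x y : ℕ)
  /-- `x := y + 1` -/
  | succ (x y : ℕ)
  /-- `x := A_a[i, j]` -/
  | load (x a i j : ℕ)
  /-- `A_a[i, j] := x` -/
  | store (a i j x : ℕ)
  /-- `c; d` -/
  | seq (c d : Cmd)
  /-- `if x = y then c else d` -/
  | ifEq (x y : ℕ) (c d : Cmd)
  /-- `if x < y then c else d` -/
  | ifLt (x y : ℕ) (c d : Cmd)
  /-- `for x = 0, …, y - 1 do c`, with the value that `y` has at the beginning -/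
  | loop (x y : ℕ) (c : Cmd)

/-- The final memory and the number of steps of a program.  An elementary command, a test, and
the start and each round of a loop count one step. -/
def exec : Cmd → State → State × ℕ
  | .skip, σ => (σ, 1)
  | .zero x, σ => (σ.setVar x 0, 1)
  | .copy x y, σ => (σ.setVar x (σ.var y), 1)
  | .succ x y, σ => (σ.setVar x (σ.var y + 1), 1)
  | .load x a i j, σ => (σ.setVar x (σ.arr a (σ.var i) (σ.var j)), 1)
  | .store a i j x, σ => (σ.setArr a (σ.var i) (σ.var j) (σ.var x), 1)
  | .seq c d, σ => ((exec d (exec c σ).1).1, (exec c σ).2 + (exec d (exec c σ).1).2)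
  | .ifEq x y c d, σ =>
      if σ.var x = σ.var y then ((exec c σ).1, (exec c σ).2 + 1)
      else ((exec d σ).1, (exec d σ).2 + 1)
  | .ifLt x y c d, σ =>
      if σ.var x < σ.var y then ((exec c σ).1, (exec c σ).2 + 1)
      else ((exec d σ).1, (exec d σ).2 + 1)
  | .loop x y c, σ =>
      (List.range (σ.var y)).foldl
        (fun p i => ((exec c (p.1.setVar x i)).1, p.2 + (exec c (p.1.setVar x i)).2 + 1))
        (σ, 1)

open Classical in
/-- The initial memory for the input `(G, s)` with vertices `0, …, n - 1`: `x₀ = n`, `x₁ = s`,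
`A₀` is the adjacency matrix, and everything else is `0`. -/
noncomputable def input {n : ℕ} (G : Digraph (Fin n)) (s : Fin n) : State where
  var x := if x = 0 then n else if x = 1 then (s : ℕ) else 0
  arr a i j := if a = 0 ∧ ∃ (hi : i < n) (hj : j < n), G.Adj ⟨i, hi⟩ ⟨j, hj⟩ then 1 else 0

/-- Array `A_a` holds, in its first row, the sequence `U` of vertices. -/
def HoldsSeq {n : ℕ} (σ : State) (a : ℕ) (U : List (Fin n)) : Prop :=
  ∀ (k : ℕ) (hk : k < U.length), σ.arr a 0 k = (U[k] : ℕ)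

/-- Array `A_a` holds, in its first row, the characteristic function of the set `S`. -/
def HoldsSet {n : ℕ} (σ : State) (a : ℕ) (S : Set (Fin n)) : Prop :=
  ∀ v : Fin n, (v ∈ S → σ.arr a 0 v = 1) ∧ (v ∉ S → σ.arr a 0 v = 0)

end Ram

namespace Digraph

/-! ### Depth-first search -/

/-! The point is to describe the sets `P*(w)` without reference to the spanning tree. In a reducible
flow graph a cycle arc `vw` enters a vertex `w` that dominates `v`; otherwise some search could
descend along a path from `s` to `v` that avoids `w` and then take `vw` as a tree arc
(`IsReducible.not_reachAvoid`). Hence the algorithm works with natural loops (`InLoop`), which are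
defined by dominance and backward reachability alone. If two loops with different heads share a
vertex, one of them contains the head of the other (`inLoop_or_inLoop`), and loops are transitive
(`InLoop.trans`). So every vertex other than `s` has exactly one innermost loop, and
`DFST.mem_pStar` identifies `P*(w)` with the vertices whose innermost loop is that of `w`. The tests
succeed because a dominator is an ancestor in every depth-first tree.

Sending a vertex to the head of its innermost loop makes `V` a tree with root `s`, and the
admissible partitions of the boxes are the proper 2-colourings of this tree (`DFST.LROutput.spec`,
`DFST.lrOutput_of_isTopOrder`). The parity of the nesting depth is one of them
(`isHeadColoring_odd`).

A set `S` that contains no vertex together with its innermost head induces an acyclic graph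
(`IsHeadIndependent.transGen_irrefl`). On a closed walk in `S`, consider the strongly connected part
and its vertex `m` of least preorder number. The rest of this part lies in the loop of `m`, and a
successor of `m` in it has `m` as innermost head, since a loop nested inside that of `m` and
containing the successor would also contain `m`. So both colour classes have topological orders, and
an arc between the classes is harmless because all of `R` precedes all of `L`.

The program computes non-dominance and loops by transitive closure, then innermost heads and depth
parities, and finally sorts greedily. None of these data depend on a tree, so one output is valid
for all trees. All its loops have `n` rounds, which bounds the time by a polynomial. -/

/-- The facts about a state of a depth-first search from `s` that every step preserves. -/
structure DFSInv {V : Type*} [DecidableEq V] (G : Digraph V) (s : V) (σ : DFSState V) : Prop where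
  nodup : σ.visited.Nodup
  root : s ∈ σ.visited
  stack_sub : ∀ v ∈ σ.stack, v ∈ σ.visited
  finished : ∀ v ∈ σ.visited, v ∉ σ.stack → ∀ w, G.Adj v w → w ∈ σ.visited
  tree_adj : ∀ a b, σ.tree a b → G.Adj a b
  tree_lt : ∀ a b, σ.tree a b → a ∈ σ.visited ∧ b ∈ σ.visited ∧
    σ.visited.idxOf a < σ.visited.idxOf b
  reach : ∀ v ∈ σ.visited, Relation.ReflTransGen σ.tree s v
  stack_pairwise : σ.stack.Pairwise fun a b =>
    Relation.ReflTransGen σ.tree b a ∧ σ.visited.idxOf b < σ.visited.idxOf a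
  stack_anc : ∀ a ∈ σ.stack, ∀ m, Relation.ReflTransGen σ.tree m a → m ∈ σ.stack
  stack_desc : ∀ m ∈ σ.stack, ∀ b ∈ σ.visited, σ.visited.idxOf m ≤ σ.visited.idxOf b →
    Relation.ReflTransGen σ.tree m b
  arc : ∀ a ∈ σ.visited, ∀ b ∈ σ.visited, G.Adj a b → σ.visited.idxOf a < σ.visited.idxOf b →
    Relation.ReflTransGen σ.tree a b
  interval : ∀ m ∈ σ.visited, ∀ a ∈ σ.visited, ∀ b ∈ σ.visited,
    Relation.ReflTransGen σ.tree m a → σ.visited.idxOf m ≤ σ.visited.idxOf b →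
    σ.visited.idxOf b ≤ σ.visited.idxOf a → Relation.ReflTransGen σ.tree m b

section

variable {V : Type*} [DecidableEq V] {G : Digraph V} {s : V}

theorem DFSInv.initial (G : Digraph V) (s : V) :
    DFSInv G s ⟨[s], [s], fun _ _ => False⟩ where
  nodup := by simp
  root := by simp
  stack_sub := by simp
  finished := by simp
  tree_adj := by simp
  tree_lt := by simp
  reach := by simp [Relation.ReflTransGen.refl]
  stack_pairwise := by simp
  stack_anc := by
    intro a ha m hm
    rcases Relation.ReflTransGen.cases_tail hm with h | ⟨c, -, h⟩
    · exact h ▸ ha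
    · exact h.elim
  stack_desc := by simp [Relation.ReflTransGen.refl]
  arc := by simp
  interval := by simp [Relation.ReflTransGen.refl]

theorem DFSInv.idxOf_le {σ : DFSState V} (h : DFSInv G s σ) {a b : V}
    (hab : Relation.ReflTransGen σ.tree a b) : σ.visited.idxOf a ≤ σ.visited.idxOf b := by
  induction hab with
  | refl => exact le_rfl
  | tail _ hbc ih => exact ih.trans (h.tree_lt _ _ hbc).2.2.le

theorem DFSInv.step {σ τ : DFSState V} (h : DFSInv G s σ) (hst : DFSStep G σ τ) :
    DFSInv G s τ := by
  cases hst with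
  | backtrack vis st t v hv =>
    have hpw := List.pairwise_cons.1 h.stack_pairwise
    refine
      { nodup := h.nodup
        root := h.root
        stack_sub := fun x hx => h.stack_sub x (List.mem_cons_of_mem _ hx)
        finished := ?_
        tree_adj := h.tree_adj
        tree_lt := h.tree_lt
        reach := h.reach
        stack_pairwise := hpw.2
        stack_anc := ?_
        stack_desc := fun m hm => h.stack_desc m (List.mem_cons_of_mem _ hm)
        arc := h.arc
        interval := h.interval }
    · intro x hx hxs w hw
      by_cases hxv : x = v
      · subst hxv; exact hv w hw
      · exact h.finished x hx (by simpa [hxv] using hxs) w hw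
    -- Only the popped vertex `v` could be missing from the stack, and `v` is numbered after
    -- everything below it, so it is no ancestor of `a`.
    · intro a ha m hm
      rcases List.mem_cons.1 (h.stack_anc a (List.mem_cons_of_mem _ ha) m hm) with rfl | h'
      · exact absurd (h.idxOf_le hm) (not_le.2 (hpw.1 a ha).2)
      · exact h'
  | descend vis st t v w hvw hw =>
    have hmono : ∀ {a b}, Relation.ReflTransGen t a b →
        Relation.ReflTransGen (fun a b => t a b ∨ (a = v ∧ b = w)) a b :=
      fun hab => Relation.ReflTransGen.mono (fun _ _ => Or.inl) _ _ hab
    have hvv : v ∈ vis := h.stack_sub v List.mem_cons_self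
    -- The new vertex `w` is a leaf: a tree path that ends in an old vertex cannot use the new arc.
    have hold : ∀ {a b}, Relation.ReflTransGen (fun a b => t a b ∨ (a = v ∧ b = w)) a b →
        b ∈ vis → Relation.ReflTransGen t a b := by
      intro a b hab
      induction hab with
      | refl => exact fun _ => .refl
      | tail _ hbc ih =>
        intro hc
        rcases hbc with hbc | ⟨-, rfl⟩
        · exact (ih (h.tree_lt _ _ hbc).1).tail hbc
        · exact absurd hc hw
    have htow : ∀ {m}, Relation.ReflTransGen (fun a b => t a b ∨ (a = v ∧ b = w)) m w →
        m = w ∨ Relation.ReflTransGen t m v := by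
      intro m hm
      rcases Relation.ReflTransGen.cases_tail hm with h' | ⟨c, hc, h' | ⟨rfl, -⟩⟩
      · exact Or.inl h'.symm
      · exact absurd (h.tree_lt _ _ h').2.1 hw
      · exact Or.inr (hold hc hvv)
    have hvw' : Relation.ReflTransGen (fun a b => t a b ∨ (a = v ∧ b = w)) v w :=
      .single (Or.inr ⟨rfl, rfl⟩)
    have hidx : ∀ {a}, a ∈ vis → (vis ++ [w]).idxOf a = vis.idxOf a :=
      fun ha => List.idxOf_append_of_mem ha
    have hidw : (vis ++ [w]).idxOf w = vis.length := by
      rw [List.idxOf_append_of_notMem hw]; simp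
    have hlt : ∀ {a}, a ∈ vis → vis.idxOf a < vis.length := fun ha => List.idxOf_lt_length_of_mem ha
    have hpw := List.pairwise_cons.1 h.stack_pairwise
    have hstv : ∀ a ∈ v :: st, Relation.ReflTransGen t a v := by
      intro a ha
      rcases List.mem_cons.1 ha with rfl | ha
      · exact .refl
      · exact (hpw.1 a ha).1
    refine
      { nodup := ?_
        root := by simp [h.root]
        stack_sub := ?_
        finished := ?_
        tree_adj := ?_
        tree_lt := ?_
        reach := ?_
        stack_pairwise := ?_
        stack_anc := ?_
        stack_desc := ?_
        arc := ?_
        interval := ?_ }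
    · exact List.nodup_append.2 ⟨h.nodup, by simp, by
        intro a ha b hb; simp at hb; rintro rfl; exact hw (hb ▸ ha)⟩
    · intro x hx
      rcases List.mem_cons.1 hx with rfl | hx
      · simp
      · simp [h.stack_sub x hx]
    · intro x hx hxs y hy
      have hxw : x ≠ w := fun e => hxs (by simp [e])
      have hxv : x ∈ vis := by simpa [hxw] using hx
      exact List.mem_append_left _
        (h.finished x hxv (fun h' => hxs (List.mem_cons_of_mem _ h')) y hy)
    · rintro a b (hab | ⟨rfl, rfl⟩)
      · exact h.tree_adj a b hab
      · exact hvw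
    · rintro a b (hab | ⟨rfl, rfl⟩)
      · obtain ⟨h1, h2, h3⟩ := h.tree_lt a b hab
        refine ⟨by simp [h1], by simp [h2], ?_⟩
        show (vis ++ [w]).idxOf a < (vis ++ [w]).idxOf b
        rw [hidx h1, hidx h2]; exact h3
      · refine ⟨by simp [hvv], by simp, ?_⟩
        show (vis ++ [b]).idxOf a < (vis ++ [b]).idxOf b
        rw [hidw, hidx hvv]; exact hlt hvv
    · intro x hx
      rcases List.mem_append.1 hx with hx | hx
      · exact hmono (h.reach x hx)
      · obtain rfl := List.mem_singleton.1 hx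
        exact (hmono (h.reach v hvv)).trans hvw'
    · refine List.pairwise_cons.2 ⟨?_, ?_⟩
      · intro b hb
        refine ⟨(hmono (hstv b hb)).trans hvw', ?_⟩
        show (vis ++ [w]).idxOf b < (vis ++ [w]).idxOf w
        rw [hidw, hidx (h.stack_sub b hb)]; exact hlt (h.stack_sub b hb)
      · refine h.stack_pairwise.imp_of_mem ?_
        intro a b ha hb hab
        refine ⟨hmono hab.1, ?_⟩
        show (vis ++ [w]).idxOf b < (vis ++ [w]).idxOf a
        rw [hidx (h.stack_sub b hb), hidx (h.stack_sub a ha)]; exact hab.2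
    · intro a ha m hm
      rcases List.mem_cons.1 ha with rfl | ha
      · rcases htow hm with rfl | hm
        · exact List.mem_cons_self
        · exact List.mem_cons_of_mem _ (h.stack_anc v List.mem_cons_self m hm)
      · exact List.mem_cons_of_mem _ (h.stack_anc a ha m (hold hm (h.stack_sub a ha)))
    · intro m hm b hb hmb
      rcases List.mem_cons.1 hm with hm' | hm'
      · subst hm'
        rcases List.mem_append.1 hb with hb' | hb'
        · exact absurd hmb (by
            show ¬ (vis ++ [m]).idxOf m ≤ (vis ++ [m]).idxOf b
            rw [hidw, hidx hb']; exact not_le.2 (hlt hb'))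
        · rw [List.mem_singleton.1 hb']
      · rcases List.mem_append.1 hb with hb' | hb'
        · refine hmono (h.stack_desc m hm' b hb' ?_)
          have : (vis ++ [w]).idxOf m ≤ (vis ++ [w]).idxOf b := hmb
          rwa [hidx (h.stack_sub m hm'), hidx hb'] at this
        · rw [List.mem_singleton.1 hb']
          exact (hmono (hstv m hm')).trans hvw'
    · intro a ha b hb hab hlt'
      have hlt' : (vis ++ [w]).idxOf a < (vis ++ [w]).idxOf b := hlt'
      rcases List.mem_append.1 hb with hb' | hb'
      · rcases List.mem_append.1 ha with ha' | ha'
        · rw [hidx ha', hidx hb'] at hlt'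
          exact hmono (h.arc a ha' b hb' hab hlt')
        · rw [List.mem_singleton.1 ha', hidw, hidx hb'] at hlt'
          exact absurd (hlt hb') (by omega)
      · rw [List.mem_singleton.1 hb'] at hab ⊢
        rcases List.mem_append.1 ha with ha' | ha'
        · by_cases has : a ∈ v :: st
          · exact (hmono (hstv a has)).trans hvw'
          · exact absurd (h.finished a ha' has w hab) hw
        · rw [List.mem_singleton.1 ha']
    · intro m hm a ha b hb hma h1 h2
      have h1 : (vis ++ [w]).idxOf m ≤ (vis ++ [w]).idxOf b := h1
      have h2 : (vis ++ [w]).idxOf b ≤ (vis ++ [w]).idxOf a := h2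
      rcases List.mem_append.1 hm with hm' | hm'
      · rcases List.mem_append.1 hb with hb' | hb'
        · rw [hidx hm', hidx hb'] at h1
          rcases List.mem_append.1 ha with ha' | ha'
          · rw [hidx ha', hidx hb'] at h2
            exact hmono (h.interval m hm' a ha' b hb' (hold hma ha') h1 h2)
          · rw [List.mem_singleton.1 ha'] at hma
            rcases htow hma with hmw | hmv
            · exact absurd (hmw ▸ hm') hw
            -- An ancestor of the current vertex is still on the stack, so everything visited since
            -- then descends from it.
            · exact hmono (h.stack_desc m (h.stack_anc v List.mem_cons_self m hmv) b hb' h1)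
        · rw [List.mem_singleton.1 hb'] at h2 ⊢
          rcases List.mem_append.1 ha with ha' | ha'
          · rw [hidw, hidx ha'] at h2
            exact absurd (hlt ha') (by omega)
          · rwa [List.mem_singleton.1 ha'] at hma
      · rw [List.mem_singleton.1 hm'] at h1 ⊢
        rcases List.mem_append.1 hb with hb' | hb'
        · rw [hidw, hidx hb'] at h1
          exact absurd (hlt hb') (by omega)
        · rw [List.mem_singleton.1 hb']

theorem DFSInv.of_run {σ τ : DFSState V} (h : DFSInv G s σ)
    (hr : Relation.ReflTransGen (DFSStep G) σ τ) : DFSInv G s τ := by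
  induction hr with
  | refl => exact h
  | tail _ hst ih => exact ih.step hst

end

/-! ### Ancestors and preorder numbers in a finished search. -/

namespace DFST

variable {V : Type*} [DecidableEq V] {G : Digraph V} {s : V}

theorem inv (T : DFST G s) : DFSInv G s ⟨T.visited, [], T.tree⟩ :=
  (DFSInv.initial G s).of_run T.run

theorem mem_visited (T : DFST G s) (hG : G.IsFlowGraph s) (v : V) : v ∈ T.visited := by
  induction hG.2 v with
  | refl => exact T.inv.root
  | tail _ hbc ih => exact T.inv.finished _ ih (by simp) _ hbc

theorem po_injective (T : DFST G s) (hG : G.IsFlowGraph s) : Function.Injective T.po := by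
  intro a b hab
  have : T.visited.idxOf a = T.visited.idxOf b := by simpa [po] using hab
  exact (List.idxOf_inj (T.mem_visited hG a)).1 this

theorem anc_root (T : DFST G s) (hG : G.IsFlowGraph s) (v : V) : T.Anc s v :=
  T.inv.reach v (T.mem_visited hG v)

theorem po_le_of_anc (T : DFST G s) {a b : V} (h : T.Anc a b) : T.po a ≤ T.po b :=
  Nat.succ_le_succ (T.inv.idxOf_le h)

theorem po_lt_of_tree (T : DFST G s) {a b : V} (h : T.tree a b) : T.po a < T.po b :=
  Nat.succ_lt_succ (T.inv.tree_lt a b h).2.2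

theorem po_lt_of_anc_of_ne (T : DFST G s) (hG : G.IsFlowGraph s) {a b : V} (h : T.Anc a b)
    (hne : a ≠ b) : T.po a < T.po b :=
  lt_of_le_of_ne (T.po_le_of_anc h) fun e => hne (T.po_injective hG e)

theorem anc_antisymm (T : DFST G s) (hG : G.IsFlowGraph s) {a b : V} (h : T.Anc a b)
    (h' : T.Anc b a) : a = b :=
  T.po_injective hG (le_antisymm (T.po_le_of_anc h) (T.po_le_of_anc h'))

theorem anc_of_adj (T : DFST G s) (hG : G.IsFlowGraph s) {a b : V} (h : G.Adj a b)
    (hlt : T.po a < T.po b) : T.Anc a b :=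
  T.inv.arc a (T.mem_visited hG a) b (T.mem_visited hG b) h (Nat.lt_of_succ_lt_succ hlt)

theorem anc_interval (T : DFST G s) (hG : G.IsFlowGraph s) {m a b : V} (h : T.Anc m a)
    (h1 : T.po m ≤ T.po b) (h2 : T.po b ≤ T.po a) : T.Anc m b :=
  T.inv.interval m (T.mem_visited hG m) a (T.mem_visited hG a) b (T.mem_visited hG b) h
    (Nat.le_of_succ_le_succ h1) (Nat.le_of_succ_le_succ h2)

/-- A step along an arc within the vertices numbered at least `po m` does not leave the subtree
of `m`. -/
theorem anc_step (T : DFST G s) (hG : G.IsFlowGraph s) {m a b : V} (h : T.Anc m a)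
    (hab : G.Adj a b) (hb : T.po m ≤ T.po b) : T.Anc m b := by
  rcases lt_or_ge (T.po a) (T.po b) with hlt | hge
  · exact h.trans (T.anc_of_adj hG hab hlt)
  · exact T.anc_interval hG h hb hge

end DFST

/-! ### Existence of depth-first searches -/

section

variable {V : Type*} {G : Digraph V} {s : V}

/-- Any partial search can be completed. The survival of the tree arcs makes it possible to
prescribe a tree arc by prescribing the beginning of a search. -/
theorem exists_run_of_state [Finite V] (G : Digraph V) (σ : DFSState V) :
    ∃ vis t, Relation.ReflTransGen (DFSStep G) σ ⟨vis, [], t⟩ ∧ ∀ a b, σ.tree a b → t a b := by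
  classical
  have := Fintype.ofFinite V
  -- The factor 2 makes the measure drop when descending, which uses up one unvisited vertex but
  -- lengthens the stack by one.
  induction hn : 2 * (Finset.univ.filter (fun x => x ∉ σ.visited)).card + σ.stack.length using
    Nat.strong_induction_on generalizing σ with
  | _ n ih =>
  obtain ⟨vis, st, t⟩ := σ
  cases st with
  | nil => exact ⟨vis, t, .refl, fun _ _ h => h⟩
  | cons v st =>
    by_cases h : ∃ w, G.Adj v w ∧ w ∉ vis
    · obtain ⟨w, hvw, hw⟩ := h
      have hcard : (Finset.univ.filter (fun x => x ∉ vis ++ [w])).card <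
          (Finset.univ.filter (fun x => x ∉ vis)).card := by
        apply Finset.card_lt_card
        rw [Finset.ssubset_iff_of_subset]
        · exact ⟨w, by simp [hw], by simp⟩
        · intro x; simp +contextual
      obtain ⟨vis', t', hr, ht⟩ := ih _ (by simp at hn hcard ⊢; omega)
        ⟨vis ++ [w], w :: v :: st, fun a b => t a b ∨ (a = v ∧ b = w)⟩ rfl
      exact ⟨vis', t', .head (.descend vis st t v w hvw hw) hr, fun a b h => ht a b (Or.inl h)⟩
    · push Not at h
      obtain ⟨vis', t', hr, ht⟩ := ih _ (by simp at hn ⊢; omega) ⟨vis, st, t⟩ rfl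
      exact ⟨vis', t', .head (.backtrack vis st t v h) hr, ht⟩

theorem nonempty_dfst [Finite V] (G : Digraph V) (s : V) : Nonempty (DFST G s) := by
  obtain ⟨vis, t, hr, -⟩ := exists_run_of_state G ⟨[s], [s], fun _ _ => False⟩
  exact ⟨⟨vis, t, hr⟩⟩

/-- The (reversed) simple paths of `G` that start in `s` and avoid `w` afterwards. -/
inductive PathStack (G : Digraph V) (s w : V) : List V → Prop
  | base : PathStack G s w [s]
  | step (c v : V) (st : List V) : PathStack G s w (v :: st) → G.Adj v c → c ∉ v :: st → c ≠ w →
      PathStack G s w (c :: v :: st)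

/-- Cutting a path back at a vertex it already contains; this turns walks into simple paths. -/
theorem PathStack.truncate {w : V} {st : List V} (h : PathStack G s w st) :
    ∀ c ∈ st, ∃ st', PathStack G s w (c :: st') := by
  induction h with
  | base => intro c hc; obtain rfl := List.mem_singleton.1 hc; exact ⟨[], .base⟩
  | step c v st h1 h2 h3 h4 ih =>
    intro x hx
    rcases List.mem_cons.1 hx with rfl | hx
    · exact ⟨_, .step x v st h1 h2 h3 h4⟩
    · exact ih x hx

/-- A search may start by descending along any simple path, without backtracking. -/
theorem PathStack.run {w : V} {st : List V} (h : PathStack G s w st) :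
    ∃ t, Relation.ReflTransGen (DFSStep G) ⟨[s], [s], fun _ _ => False⟩ ⟨st.reverse, st, t⟩ := by
  induction h with
  | base => exact ⟨_, .refl⟩
  | step c v st _ h2 h3 _ ih =>
    obtain ⟨t, ht⟩ := ih
    have := DFSStep.descend (v :: st).reverse st t v c h2 (by rwa [List.mem_reverse])
    rw [← List.reverse_cons] at this
    exact ⟨_, ht.tail this⟩

theorem PathStack.notMem {w : V} (hw : w ≠ s) {st : List V} (h : PathStack G s w st) :
    w ∉ st := by
  induction h with
  | base => simpa using hw
  | step c v st _ _ _ h4 ih => simp only [List.mem_cons, not_or] at ih ⊢; exact ⟨h4.symm, ih⟩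

/-! ### Dominance, and what reducibility says about it. -/

/-- `v` can be reached from `s` on a path that avoids `w`, i.e. `w` does not dominate `v`. -/
def ReachAvoid (G : Digraph V) (s w v : V) : Prop :=
  s ≠ w ∧ Relation.ReflTransGen (fun a b => G.Adj a b ∧ b ≠ w) s v

theorem ReachAvoid.exists_pathStack {w v : V} (h : G.ReachAvoid s w v) :
    ∃ st, PathStack G s w (v :: st) := by
  obtain ⟨-, h⟩ := h
  induction h with
  | refl => exact ⟨[], .base⟩
  | @tail b c _ hbc ih =>
    obtain ⟨st, hst⟩ := ih
    by_cases hc : c ∈ b :: st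
    · exact hst.truncate c hc
    · exact ⟨_, .step c b st hst hbc.1 hc hbc.2⟩

/-- Descend along a simple path to `v` that avoids `w`. Then `w` is still unvisited, so the next
descent may use `vw`. -/
theorem ReachAvoid.exists_dfst [Finite V] {w v : V} (h : G.ReachAvoid s w v) (hvw : G.Adj v w) :
    ∃ T : DFST G s, T.tree v w := by
  obtain ⟨st, hst⟩ := h.exists_pathStack
  obtain ⟨t, ht⟩ := hst.run
  have hw : w ∉ (v :: st).reverse := by
    rw [List.mem_reverse]; exact hst.notMem h.1.symm
  obtain ⟨vis, t', hr, ht'⟩ := exists_run_of_state G _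
  exact ⟨⟨vis, t', (ht.tail (.descend _ _ _ _ _ hvw hw)).trans hr⟩, ht' v w (Or.inr ⟨rfl, rfl⟩)⟩

/-- In a reducible flow graph, a vertex that is entered by a cycle arc dominates its tail. -/
theorem IsReducible.not_reachAvoid [Finite V] [DecidableEq V] (hG : G.IsReducible s)
    (T : DFST G s) {v w : V} (h : T.CycleArc v w) : ¬ G.ReachAvoid s w v := by
  intro ha
  obtain ⟨T', hT'⟩ := ha.exists_dfst h.1
  have hne : v ≠ w := by rintro rfl; exact hG.1.1 _ h.1
  -- By reducibility `vw`, a tree arc of `T'`, is a tree, forward or cross arc of `T`; each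
  -- contradicts its being a cycle arc there.
  rcases (hG.2 T T' v w).2 (Or.inl ⟨h.1, hT'⟩) with h' | h' | h'
  · exact absurd (T.po_lt_of_tree h'.2) (not_lt.2 (T.po_le_of_anc h.2))
  · exact hne (T.anc_antisymm hG.1 h'.2.2 h.2)
  · exact h'.2.2.1 h.2

/-- The tree path from `s` to `v` must meet a dominator of `v`. Reducibility is not needed. -/
theorem anc_of_not_reachAvoid [DecidableEq V] (hG : G.IsFlowGraph s) (T : DFST G s) {w v : V}
    (h : ¬ G.ReachAvoid s w v) : T.Anc w v := by
  by_cases hsw : s = w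
  · exact hsw ▸ T.anc_root hG v
  · have key : ∀ x, T.Anc s x → T.Anc w x ∨ G.ReachAvoid s w x := by
      intro x hx
      induction hx with
      | refl => exact Or.inr ⟨hsw, .refl⟩
      | @tail b c _ hbc ih =>
        by_cases hc : c = w
        · exact Or.inl (hc ▸ .refl)
        · rcases ih with ih | ih
          · exact Or.inl (ih.tail hbc)
          · exact Or.inr ⟨hsw, ih.2.tail ⟨T.inv.tree_adj _ _ hbc, hc⟩⟩
    exact (key v (T.anc_root hG v)).resolve_right h

theorem reachAvoid_of_adj {w a b : V} (h : G.ReachAvoid s w a) (hab : G.Adj a b) (hb : b ≠ w) :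
    G.ReachAvoid s w b :=
  ⟨h.1, h.2.tail ⟨hab, hb⟩⟩

end

end Digraph

namespace Digraph

variable {V : Type*} {G : Digraph V} {s : V}

/-! ### Natural loops -/

/-- `v` belongs to the natural loop of `w`: a path that avoids `w` leads from `v` to some `z`
that is dominated by `w` and has an arc to `w`.  All vertices belong to the loop of the root. -/
def InLoop (G : Digraph V) (s w v : V) : Prop :=
  v ≠ w ∧ (w = s ∨ ∃ z, G.Adj z w ∧ ¬ G.ReachAvoid s w z ∧
    Relation.ReflTransGen (fun a b => G.Adj a b ∧ a ≠ w ∧ b ≠ w) v z)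

/-- The loop of `w` is the innermost one that contains `v`. -/
def IsInnermost (G : Digraph V) (s w v : V) : Prop :=
  G.InLoop s w v ∧ ∀ u, G.InLoop s u v → ¬ G.InLoop s w u

/-- A path from `s` to `v` avoiding `w` could be continued inside the loop to `z`, which `w`
dominates. -/
theorem InLoop.not_reachAvoid {w v : V} (h : G.InLoop s w v) : ¬ G.ReachAvoid s w v := by
  rcases h.2 with rfl | ⟨z, hzw, hz, hp⟩
  · exact fun h' => h'.1 rfl
  · induction hp using Relation.ReflTransGen.head_induction_on with
    | refl => exact hz
    | @head a b hab hp ih =>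
      exact fun h' => ih ⟨hab.2.2, Or.inr ⟨z, hzw, hz, hp⟩⟩ (reachAvoid_of_adj h' hab.1 hab.2.2)

/-- Backward closure of loops, from which the nesting properties below follow. -/
theorem InLoop.of_adj {w a b : V} (h : G.InLoop s w b) (hab : G.Adj a b) (ha : a ≠ w) :
    G.InLoop s w a := by
  refine ⟨ha, ?_⟩
  rcases h.2 with hw | ⟨z, hzw, hz, hp⟩
  · exact Or.inl hw
  · exact Or.inr ⟨z, hzw, hz, hp.head ⟨hab, ha, h.1⟩⟩

section

variable [DecidableEq V]

theorem InLoop.anc (hG : G.IsFlowGraph s) (T : DFST G s) {w v : V} (h : G.InLoop s w v) :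
    T.Anc w v :=
  anc_of_not_reachAvoid hG T h.not_reachAvoid

theorem InLoop.po_lt (hG : G.IsFlowGraph s) (T : DFST G s) {w v : V} (h : G.InLoop s w v) :
    T.po w < T.po v :=
  T.po_lt_of_anc_of_ne hG (h.anc hG T) h.1.symm

theorem not_inLoop_root (hG : G.IsFlowGraph s) (T : DFST G s) (w : V) : ¬ G.InLoop s w s :=
  fun h => absurd (h.po_lt hG T) (not_lt.2 (T.po_le_of_anc (T.anc_root hG w)))

theorem inLoop_of_cycleArc [Finite V] (hG : G.IsReducible s) (T : DFST G s) {z w : V}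
    (h : T.CycleArc z w) : G.InLoop s w z :=
  ⟨by rintro rfl; exact hG.1.1 _ h.1, Or.inr ⟨z, h.1, hG.not_reachAvoid T h, .refl⟩⟩

theorem InLoop.isHead (hG : G.IsFlowGraph s) (T : DFST G s) {w v : V} (h : G.InLoop s w v)
    (hw : w ≠ s) : T.IsHead w := by
  rcases h.2 with rfl | ⟨z, hzw, hz, -⟩
  · exact absurd rfl hw
  · exact ⟨hw, z, hzw, anc_of_not_reachAvoid hG T hz⟩

/-- Go backward along the tree path from `w` to `x`: its vertices are numbered at least `po w`, so
it never meets `u`, and backward closure applies. -/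
theorem inLoop_of_anc (T : DFST G s) {u w x : V} (hu : G.InLoop s u x)
    (huw : T.po u < T.po w) (hw : T.Anc w x) : G.InLoop s u w := by
  induction hw using Relation.ReflTransGen.head_induction_on with
  | refl => exact hu
  | @head a b hab hbx ih =>
    refine (ih (huw.trans (T.po_lt_of_tree hab))).of_adj (T.inv.tree_adj _ _ hab) ?_
    rintro rfl; exact lt_irrefl _ huw

/-- Both heads are ancestors of `x`; the one with the larger number lies in the loop of the other.
-/
theorem inLoop_or_inLoop (hG : G.IsFlowGraph s) (T : DFST G s) {u w x : V}
    (hu : G.InLoop s u x) (hw : G.InLoop s w x) (hne : u ≠ w) :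
    G.InLoop s u w ∨ G.InLoop s w u := by
  rcases lt_trichotomy (T.po u) (T.po w) with h | h | h
  · exact Or.inl (inLoop_of_anc T hu h (hw.anc hG T))
  · exact absurd (T.po_injective hG h) hne
  · exact Or.inr (inLoop_of_anc T hw h (hu.anc hG T))

/-- The path from `x` inside the loop of `w`, extended by the arc to `w`, ends in the loop of `u`.
All its vertices have larger numbers than `u`, so backward closure carries membership to `x`. -/
theorem InLoop.trans (hG : G.IsFlowGraph s) (T : DFST G s) {u w x : V}
    (hu : G.InLoop s u w) (hw : G.InLoop s w x) : G.InLoop s u x := by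
  have hlt := hu.po_lt hG T
  have hne : ∀ y, G.InLoop s w y → y ≠ u := by
    rintro y hy rfl
    exact lt_asymm hlt (hy.po_lt hG T)
  rcases hw.2 with rfl | ⟨z, hzw, hz, hp⟩
  · exact absurd hu (not_inLoop_root hG T u)
  · clear hw
    induction hp using Relation.ReflTransGen.head_induction_on with
    | refl =>
      have hzne : z ≠ w := by rintro rfl; exact hG.1 _ hzw
      exact hu.of_adj hzw (hne z ⟨hzne, Or.inr ⟨z, hzw, hz, .refl⟩⟩)
    | @head a b hab hp ih =>
      exact ih.of_adj hab.1 (hne a ⟨hab.2.1, Or.inr ⟨z, hzw, hz, hp.head hab⟩⟩)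

theorem IsInnermost.unique (hG : G.IsFlowGraph s) (T : DFST G s) {u w v : V}
    (hu : G.IsInnermost s u v) (hw : G.IsInnermost s w v) : u = w := by
  by_contra hne
  rcases inLoop_or_inLoop hG T hu.1 hw.1 hne with h | h
  · exact hu.2 w hw.1 h
  · exact hw.2 u hu.1 h

/-- The loop of `s` contains `v`; among all loops that do, the one whose head has the largest number
is innermost. -/
theorem exists_isInnermost [Finite V] (hG : G.IsFlowGraph s) (T : DFST G s) {v : V} (hv : v ≠ s) :
    ∃ w, G.IsInnermost s w v := by
  obtain ⟨w, hw, hmax⟩ := Set.exists_max_image {w | G.InLoop s w v} T.po (Set.toFinite _)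
    ⟨s, hv, Or.inl rfl⟩
  exact ⟨w, hw, fun u hu h => not_lt.2 (hmax u hu) (h.po_lt hG T)⟩

/-! ### The sets `P*(w)` are the innermost loops -/

/-- The current graph `H` is the quotient of `G` by the map `f`, which sends each vertex to the
vertex into which the loops of the heads in `D` have collapsed it. -/
structure CollapseInv (G : Digraph V) (s : V) (D : Set V) (f : V → V) (H : Digraph V) :
    Prop where
  adj : ∀ a b, H.Adj a b ↔ a ≠ b ∧ ∃ a' b', G.Adj a' b' ∧ f a' = a ∧ f b' = b
  inLoop : ∀ v, f v ≠ v → G.InLoop s (f v) v ∧ f v ∈ D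
  not_inLoop : ∀ v, ∀ u ∈ D, ¬ G.InLoop s u (f v)

theorem CollapseInv.apply_eq {D : Set V} {f : V → V} {H : Digraph V}
    (h : CollapseInv G s D f H) {v : V} (hv : ∀ u ∈ D, ¬ G.InLoop s u v) : f v = v := by
  by_contra hne
  exact hv _ (h.inLoop v hne).2 (h.inLoop v hne).1

/-- Paths of the current graph are images of pieces of paths of `G`, and a vertex lies in the loop
of `w` exactly when its representative does. The vertices still present are those in no loop treated
so far. -/
theorem CollapseInv.pathSet_eq [Finite V] (hG : G.IsReducible s) (T : DFST G s) {D : Set V}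
    {f : V → V} {H : Digraph V} (h : CollapseInv G s D f H) {w : V} (hwD : w ∉ D) (hws : w ≠ s)
    (hw : ∀ u ∈ D, ¬ G.InLoop s u w) :
    pathSet T.Anc H w = {v | G.InLoop s w v ∧ ∀ u ∈ D, ¬ G.InLoop s u v} := by
  have hfw : f w = w := h.apply_eq hw
  -- If `x` was moved, the loops of `f x` and of `w` share `x`; as `w` is in no treated loop,
  -- nesting puts `f x` into the loop of `w`.
  have hup : ∀ x, G.InLoop s w x → G.InLoop s w (f x) := by
    intro x hx
    by_cases hne : f x = x
    · rwa [hne]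
    · obtain ⟨h1, h2⟩ := h.inLoop x hne
      exact (inLoop_or_inLoop hG.1 T h1 hx (fun e => hwD (e ▸ h2))).resolve_left (hw _ h2)
  have hdown : ∀ x, G.InLoop s w (f x) → G.InLoop s w x := by
    intro x hx
    by_cases hne : f x = x
    · rwa [hne] at hx
    · exact hx.trans hG.1 T (h.inLoop x hne).1
  ext v
  constructor
  · rintro ⟨hvw, z, hzw, hz, hp⟩
    have hfix : ∀ {a b}, H.Adj a b → ∀ u ∈ D, ¬ G.InLoop s u a := by
      rintro a b hab
      obtain ⟨-, a', b', -, rfl, -⟩ := (h.adj a b).1 hab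
      exact h.not_inLoop a'
    have hzl : G.InLoop s w z := by
      obtain ⟨hne, a', b', hab, rfl, hb⟩ := (h.adj z w).1 hzw
      -- Nothing has been collapsed into `w` yet, as `w` has not been treated; so the arc of `G`
      -- behind this one really ends in `w`.
      have hb' : b' = w := by
        by_contra hb'
        obtain ⟨-, h2⟩ := h.inLoop b' (by rw [hb]; exact fun e => hb' e.symm)
        exact hwD (hb ▸ h2)
      subst hb'
      refine hup _ (inLoop_of_cycleArc hG T ⟨hab, ?_⟩)
      by_cases hne : f a' = a'
      · rwa [hne] at hz
      · exact hz.trans ((h.inLoop a' hne).1.anc hG.1 T)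
    refine ⟨?_, ?_⟩
    · induction hp using Relation.ReflTransGen.head_induction_on with
      | refl => exact hzl
      | @head a b hab _ ih =>
        obtain ⟨hne, a', b', hab', rfl, rfl⟩ := (h.adj a b).1 hab.1
        refine hup _ ((hdown _ (ih hab.2.2)).of_adj hab' ?_)
        rintro rfl; exact hvw hfw
    · rcases Relation.ReflTransGen.cases_head hp with rfl | ⟨c, hc, -⟩
      · exact hfix hzw
      · exact hfix hc.1
  · rintro ⟨hv, hvD⟩
    -- An arc of `G` becomes an arc of `H`, or disappears when its ends have been merged.
    have hstep : ∀ {a b}, G.Adj a b → f a ≠ w → f b ≠ w →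
        Relation.ReflTransGen (fun a b => H.Adj a b ∧ a ≠ w ∧ b ≠ w) (f a) (f b) := by
      intro a b hab ha hb
      by_cases hne : f a = f b
      · rw [hne]
      · exact .single ⟨(h.adj _ _).2 ⟨hne, a, b, hab, rfl, rfl⟩, ha, hb⟩
    have hnew : ∀ x, G.InLoop s w x → f x ≠ w := fun x hx => (hup x hx).1
    refine ⟨hv.1, ?_⟩
    rcases hv.2 with e | ⟨z, hzw, hz, hp⟩
    · exact absurd e hws
    · have hzl : G.InLoop s w z :=
        ⟨by rintro rfl; exact hG.1.1 _ hzw, Or.inr ⟨z, hzw, hz, .refl⟩⟩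
      refine ⟨f z, (h.adj _ _).2 ⟨hnew z hzl, z, w, hzw, rfl, hfw⟩, (hup z hzl).anc hG.1 T, ?_⟩
      rw [← h.apply_eq hvD]
      clear hvD
      induction hp using Relation.ReflTransGen.head_induction_on with
      | refl => exact .refl
      | @head a b hab hp ih =>
        have hb : G.InLoop s w b := ⟨hab.2.2, Or.inr ⟨z, hzw, hz, hp⟩⟩
        exact (hstep hab.1 (hnew a hv) (hnew b hb)).trans (ih hb)

open Classical in
theorem CollapseInv.collapse (hG : G.IsFlowGraph s) (T : DFST G s) {D : Set V}
    {f : V → V} {H : Digraph V} (h : CollapseInv G s D f H) {w : V}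
    (hw : ∀ u ∈ D, ¬ G.InLoop s u w) {P : Set V}
    (hP : P = {v | G.InLoop s w v ∧ ∀ u ∈ D, ¬ G.InLoop s u v}) :
    CollapseInv G s (insert w D) (fun v => if f v ∈ P then w else f v) (H.collapse P w) where
  adj a b := by
    constructor
    · rintro ⟨hne, a', b', hab, ha, hb⟩
      obtain ⟨-, a'', b'', hab', rfl, rfl⟩ := (h.adj a' b').1 hab
      exact ⟨hne, a'', b'', hab', ha, hb⟩
    · rintro ⟨hne, a', b', hab, ha, hb⟩
      refine ⟨hne, f a', f b', (h.adj _ _).2 ⟨?_, a', b', hab, rfl, rfl⟩, ha, hb⟩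
      -- If the ends had already been merged, they would also have equal images after the new
      -- collapse.
      intro e
      apply hne
      rw [← ha, ← hb]
      simp only [e]
  inLoop v := by
    by_cases hv : f v ∈ P
    · have hl : G.InLoop s w (f v) := by rw [hP] at hv; exact hv.1
      simp only [hv, if_true]
      intro _
      refine ⟨?_, Set.mem_insert _ _⟩
      by_cases hne : f v = v
      · rwa [hne] at hl
      · exact hl.trans hG T (h.inLoop v hne).1
    · simp only [hv, if_false]
      exact fun hne => ⟨(h.inLoop v hne).1, Set.mem_insert_of_mem _ (h.inLoop v hne).2⟩
  not_inLoop v u hu := by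
    by_cases hv : f v ∈ P
    · simp only [hv, if_true]
      rcases hu with rfl | hu
      · exact fun h' => h'.1 rfl
      · exact hw u hu
    · simp only [hv, if_false]
      rcases hu with rfl | hu
      · intro h'; rw [hP] at hv; exact hv ⟨h', h.not_inLoop v⟩
      · exact h.not_inLoop v u hu

/-- Generalized over the state of the main loop so that induction applies. Since members of a loop
have larger numbers than its head, the decreasing order guarantees that the next head lies in no
loop treated before. -/
theorem mem_collapseLoop [Finite V] (hG : G.IsReducible s) (T : DFST G s) (ws : List V) :
    ∀ (D : Set V) (f : V → V) (H : Digraph V), CollapseInv G s D f H →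
      ws.Pairwise (fun a b => T.po b < T.po a) → (∀ w ∈ ws, w ≠ s) →
      (∀ u ∈ D, ∀ w ∈ ws, T.po w < T.po u) → ∀ x v,
      (v ∈ collapseLoop T.Anc H ws x ↔ x ∈ ws ∧ G.InLoop s x v ∧ (∀ u ∈ D, ¬ G.InLoop s u v) ∧
        ∀ u ∈ ws, T.po x < T.po u → ¬ G.InLoop s u v) := by
  induction ws with
  | nil => intro D f H _ _ _ _ x v; simp [collapseLoop]
  | cons w ws ih =>
    intro D f H h hpw hs hD x v
    have hpw' := List.pairwise_cons.1 hpw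
    have hw : ∀ u ∈ D, ¬ G.InLoop s u w := fun u hu hl =>
      lt_asymm (hD u hu w List.mem_cons_self) (hl.po_lt hG.1 T)
    have hP := h.pathSet_eq hG T (fun hwD => lt_irrefl _ (hD w hwD w List.mem_cons_self))
      (hs w List.mem_cons_self) hw
    by_cases hx : x = w
    · subst hx
      simp only [collapseLoop, if_true, hP, Set.mem_ofPred_eq, List.mem_cons, true_or, true_and]
      refine and_congr_right fun _ => ⟨fun h1 => ⟨h1, ?_⟩, fun h1 => h1.1⟩
      rintro u (rfl | hu) hlt
      · exact absurd hlt (lt_irrefl _)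
      · exact absurd hlt (lt_asymm (hpw'.1 u hu))
    · simp only [collapseLoop, hx, if_false]
      rw [ih _ _ _ (h.collapse hG.1 T hw hP) hpw'.2
        (fun y hy => hs y (List.mem_cons_of_mem _ hy))]
      · simp only [List.mem_cons, hx, false_or, Set.mem_insert_iff, forall_eq_or_imp]
        constructor
        · rintro ⟨h1, h2, ⟨h3, h4⟩, h5⟩
          exact ⟨h1, h2, h4, fun _ => h3, h5⟩
        · rintro ⟨h1, h2, h4, h3, h5⟩
          exact ⟨h1, h2, ⟨h3 (hpw'.1 x h1), h4⟩, h5⟩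
      · rintro u (rfl | hu) y hy
        · exact hpw'.1 y hy
        · exact hD u hu y (List.mem_cons_of_mem _ hy)

theorem _root_.List.Nodup.pairwise_idxOf_lt {l : List V} (h : l.Nodup) :
    l.Pairwise (fun a b => l.idxOf a < l.idxOf b) := by
  rw [List.pairwise_iff_getElem]
  intro i j hi hj hij
  rwa [h.idxOf_getElem, h.idxOf_getElem]

namespace DFST

theorem mem_heads (hG : G.IsFlowGraph s) (T : DFST G s) (w : V) : w ∈ T.heads ↔ T.IsHead w := by
  simp [heads, T.mem_visited hG]

theorem heads_pairwise (T : DFST G s) : T.heads.Pairwise (fun a b => T.po b < T.po a) := by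
  refine List.Pairwise.filter _ (List.pairwise_reverse.2 ?_)
  exact T.inv.nodup.pairwise_idxOf_lt.imp fun h => Nat.succ_lt_succ h

/-- Among the loops containing `v`, being nested deeper is the same as having a head with larger
number. -/
theorem mem_collapseLoop_heads [Finite V] (hG : G.IsReducible s) (T : DFST G s) (w v : V) :
    v ∈ collapseLoop T.Anc G T.heads w ↔ w ≠ s ∧ G.IsInnermost s w v := by
  have hinv : CollapseInv G s ∅ id G :=
    { adj := fun a b => ⟨fun h => ⟨by rintro rfl; exact hG.1.1 _ h, a, b, h, rfl, rfl⟩,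
        by rintro ⟨-, a', b', h, rfl, rfl⟩; exact h⟩
      inLoop := fun v h => absurd rfl h
      not_inLoop := fun v u hu => hu.elim }
  rw [mem_collapseLoop hG T T.heads ∅ id G hinv T.heads_pairwise
    (fun w hw => ((mem_heads hG.1 T w).1 hw).1) (fun u hu => hu.elim)]
  simp only [mem_heads hG.1]
  constructor
  · rintro ⟨h1, h2, -, h3⟩
    refine ⟨h1.1, h2, fun u hu hwu => ?_⟩
    have hus : u ≠ s := by rintro rfl; exact not_inLoop_root hG.1 T w hwu
    exact h3 u (hu.isHead hG.1 T hus) (hwu.po_lt hG.1 T) hu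
  · rintro ⟨h1, h2, h3⟩
    refine ⟨h2.isHead hG.1 T h1, h2, fun u hu => hu.elim, fun u _ hlt hu => ?_⟩
    rcases inLoop_or_inLoop hG.1 T hu h2 (by rintro rfl; exact lt_irrefl _ hlt) with h | h
    · exact lt_asymm hlt (h.po_lt hG.1 T)
    · exact h3 u hu h

/-- The right-hand side does not involve `T`; therefore one output can serve all spanning trees. -/
theorem mem_pStar [Finite V] (hG : G.IsReducible s) (T : DFST G s) (w v : V) :
    v ∈ T.pStar w ↔ G.IsInnermost s w v := by
  by_cases hw : w = s
  · subst hw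
    simp only [pStar, if_true, Set.mem_ofPred_eq, mem_collapseLoop_heads hG]
    constructor
    · rintro ⟨hv, h⟩
      obtain ⟨u, hu⟩ := exists_isInnermost hG.1 T hv
      by_cases hus : u = w
      · exact hus ▸ hu
      · exact absurd ⟨hus, hu⟩ (h u ((mem_heads hG.1 T u).2 (hu.1.isHead hG.1 T hus)))
    · rintro h
      exact ⟨h.1.1, fun u _ hu => hu.1 (hu.2.unique hG.1 T h)⟩
  · simp only [pStar, hw, if_false, mem_collapseLoop_heads hG]
    simp [hw]

theorem answersYes [Finite V] (hG : G.IsReducible s) (T : DFST G s) : T.AnswersYes :=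
  fun w _ v hv => (((mem_pStar hG T w v).1 hv).1).anc hG.1 T

theorem mem_W_of_inLoop (hG : G.IsFlowGraph s) (T : DFST G s) {w v : V} (h : G.InLoop s w v) :
    w ∈ T.W := by
  by_cases hw : w = s
  · exact Or.inr hw
  · exact Or.inl ((mem_heads hG T w).2 (h.isHead hG T hw))

end DFST

end

end Digraph

namespace Digraph

variable {V : Type*} {G : Digraph V} {s : V}

/-! ### Acyclic parts -/

/-- No vertex of `S` lies in `S` together with its innermost loop head. -/
def IsHeadIndependent (G : Digraph V) (s : V) (S : Set V) : Prop :=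
  ∀ w v, G.IsInnermost s w v → w ∈ S → v ∉ S

/-- The arcs of `G[S]`. -/
def AdjOn (G : Digraph V) (S : Set V) (a b : V) : Prop :=
  G.Adj a b ∧ a ∈ S ∧ b ∈ S

/-- The strongly connected part of `G[S]` around `a` has a vertex `m` of least number, which turns
out to be the innermost head of one of its own successors in `S`. -/
theorem IsHeadIndependent.transGen_irrefl [Finite V] [DecidableEq V] (hG : G.IsReducible s)
    {S : Set V} (hS : G.IsHeadIndependent s S) (a : V) : ¬ Relation.TransGen (G.AdjOn S) a a := by
  intro ha
  obtain ⟨T⟩ := nonempty_dfst G s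
  -- Minimizing over all vertices on closed walks through `a`, rather than over one cycle, keeps the
  -- minimality usable for every walk that returns to `m`.
  obtain ⟨m, ⟨ham, hma⟩, hmin⟩ := Set.exists_min_image
    {x | Relation.TransGen (G.AdjOn S) a x ∧ Relation.TransGen (G.AdjOn S) x a} T.po
    (Set.toFinite _) ⟨a, ha, ha⟩
  have hpo : ∀ x, Relation.TransGen (G.AdjOn S) m x →
      Relation.ReflTransGen (G.AdjOn S) x m → T.po m ≤ T.po x := fun x h1 h2 =>
    hmin x ⟨ham.trans h1, Relation.TransGen.trans_right h2 hma⟩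
  have hanc : ∀ x, Relation.TransGen (G.AdjOn S) m x →
      Relation.ReflTransGen (G.AdjOn S) x m → T.Anc m x := by
    intro x hx
    induction hx with
    | single hb => exact fun h => T.anc_step hG.1 .refl hb.1 (hpo _ (.single hb) h)
    | tail hb hbc ih =>
      exact fun h => T.anc_step hG.1 (ih (h.head hbc)) hbc.1 (hpo _ (hb.tail hbc) h)
  -- All these vertices descend from `m`, so the last arc of a return walk is a cycle arc into `m`;
  -- its tail is in the loop, and backward closure gives the rest.
  have hloop : ∀ x, Relation.ReflTransGen (G.AdjOn S) x m → Relation.TransGen (G.AdjOn S) m x →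
      x = m ∨ G.InLoop s m x := by
    intro x hx
    induction hx using Relation.ReflTransGen.head_induction_on with
    | refl => exact fun _ => Or.inl rfl
    | @head x y hxy hym ih =>
      intro hmx
      rcases ih (hmx.tail hxy) with rfl | hy
      · exact Or.inr (inLoop_of_cycleArc hG T ⟨hxy.1, hanc x hmx (.head hxy hym)⟩)
      · by_cases hxm : x = m
        · exact Or.inl hxm
        · exact Or.inr (hy.of_adj hxy.1 hxm)
  obtain ⟨x, hmx, hxm⟩ := Relation.TransGen.head'_iff.1 (hma.trans ham)
  rcases hloop x hxm (.single hmx) with rfl | hx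
  · exact hG.1.1 _ hmx.1
  -- A loop with head `u` inside the loop of `m` and containing `x` would contain the predecessor
  -- `m` of `x`, so `u` and `m` would each have the smaller number.
  · refine hS m x ⟨hx, fun u hu hmu => ?_⟩ hmx.2.1 hmx.2.2
    exact lt_asymm (hmu.po_lt hG.1 T) ((hu.of_adj hmx.1 hmu.1.symm).po_lt hG.1 T)

theorem IsDirCycle.exists_transGen {S : Set V} {c : Cycle V} (hc : G.IsDirCycle c)
    (hS : ∀ v ∈ c, v ∈ S) : ∃ a, Relation.TransGen (G.AdjOn S) a a := by
  obtain ⟨hne, -, hch⟩ := hc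
  induction c using Cycle.induction_on with
  | nil => exact absurd rfl hne
  | cons a l _ =>
    rw [Cycle.chain_coe_cons] at hch
    have hmem : ∀ x ∈ a :: (l ++ [a]), x ∈ S := by
      intro x hx
      refine hS x ?_
      simp only [List.mem_cons, List.mem_append, List.not_mem_nil, or_false] at hx
      simp only [Cycle.mem_coe_iff, List.mem_cons]
      tauto
    have key : ∀ (l : List V) (a b : V), List.IsChain G.Adj (a :: (l ++ [b])) →
        (∀ x ∈ a :: (l ++ [b]), x ∈ S) → Relation.TransGen (G.AdjOn S) a b := by
      intro l
      induction l with
      | nil =>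
        intro a b hch hmem
        exact .single ⟨by simpa using hch, hmem a (by simp), hmem b (by simp)⟩
      | cons c l ih =>
        intro a b hch hmem
        rw [List.cons_append, List.isChain_cons_cons] at hch
        exact .head ⟨hch.1, hmem a (by simp), hmem c (by simp)⟩
          (ih c b hch.2 fun x hx => hmem x (List.mem_cons_of_mem _ hx))
    exact ⟨a, key l a a hch hmem⟩

theorem isAcyclicFVS_of_acyclicOn {S : Set V} (hne : S ≠ Set.univ) (hS : G.AcyclicOn S)
    (hS' : G.AcyclicOn Sᶜ) : G.IsAcyclicFVS S := by
  refine ⟨⟨hne, fun c hc => ?_⟩, hS⟩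
  by_contra h
  push Not at h
  exact hS' c hc h

/-- `x` has to come before `y` in a standard LR-order with right part `R`. -/
def Precedes (G : Digraph V) (R : Set V) (x y : V) : Prop :=
  (x ∈ R ∧ y ∉ R) ∨ (x ∈ R ∧ y ∈ R ∧ G.Adj x y) ∨ (x ∉ R ∧ y ∉ R ∧ G.Adj y x)

theorem Precedes.ne (hG : G.IsSimple) {R : Set V} {x y : V} (h : G.Precedes R x y) : x ≠ y := by
  rintro rfl
  rcases h with h | h | h
  · exact h.2 h.1
  · exact hG _ h.2.2
  · exact hG _ h.2.2

/-- `R` and its complement form a proper colouring of the boxes. -/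
def IsHeadColoring (G : Digraph V) (s : V) (R : Set V) : Prop :=
  ∀ w v, G.IsInnermost s w v → (v ∈ R ↔ w ∉ R)

theorem IsHeadColoring.left {R : Set V} (h : G.IsHeadColoring s R) : G.IsHeadIndependent s R :=
  fun w v hwv hw hv => (h w v hwv).1 hv hw

theorem IsHeadColoring.right {R : Set V} (h : G.IsHeadColoring s R) :
    G.IsHeadIndependent s Rᶜ :=
  fun w v hwv hw hv => hv ((h w v hwv).2 hw)

section

variable [DecidableEq V]

theorem IsHeadIndependent.acyclicOn [Finite V] (hG : G.IsReducible s) {S : Set V}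
    (hS : G.IsHeadIndependent s S) : G.AcyclicOn S := by
  intro c hc hmem
  obtain ⟨a, ha⟩ := hc.exists_transGen hmem
  exact hS.transGen_irrefl hG a ha

theorem wellFounded_of_transGen_irrefl {α : Type*} [Finite α] {r : α → α → Prop}
    (h : ∀ a, ¬ Relation.TransGen r a a) : WellFounded r := by
  have : Std.Irrefl (Relation.TransGen r) := ⟨h⟩
  exact (Finite.wellFounded_of_trans_of_irrefl (Relation.TransGen r)).mono fun _ _ h => .single h

theorem IsHeadIndependent.wellFounded [Finite V] (hG : G.IsReducible s) {S : Set V}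
    (hS : G.IsHeadIndependent s S) : WellFounded (G.AdjOn S) :=
  wellFounded_of_transGen_irrefl (hS.transGen_irrefl hG)

/-- The reversed relation is needed for the left part, which is listed from its sinks. -/
theorem IsHeadIndependent.wellFounded_swap [Finite V] (hG : G.IsReducible s) {S : Set V}
    (hS : G.IsHeadIndependent s S) : WellFounded (Function.swap (G.AdjOn S)) :=
  wellFounded_of_transGen_irrefl fun a h => hS.transGen_irrefl hG a (Relation.transGen_swap.1 h)

/-! ### Linear orders as lists -/

theorem before_of_pairwise {r : V → V → Prop} {l : List V}
    (h : l.Pairwise fun a b => ¬ r b a) {x y : V} (hx : x ∈ l) (hy : y ∈ l) (hne : x ≠ y)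
    (hxy : r x y) : Before l x y := by
  by_contra hlt
  have hle : l.idxOf y ≤ l.idxOf x := not_lt.1 hlt
  have hlt' : l.idxOf y < l.idxOf x :=
    lt_of_le_of_ne hle fun e => hne ((List.idxOf_inj hy).1 e).symm
  have := List.pairwise_iff_getElem.1 h _ _ (List.idxOf_lt_length_of_mem hy)
    (List.idxOf_lt_length_of_mem hx) hlt'
  simp only [List.getElem_idxOf] at this
  exact this hxy

theorem IsTopOrder.pairwise {S : Set V} {l : List V} (h : G.IsTopOrder S l) :
    l.Pairwise fun a b => ¬ G.Adj b a := by
  refine h.1.pairwise_idxOf_lt.imp_of_mem fun ha hb hlt hba => ?_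
  exact lt_asymm hlt (h.2.2 _ ((h.2.1 _).1 hb) _ ((h.2.1 _).1 ha) hba)

theorem exists_isTopOrder [Finite V] (hG : G.IsSimple) {S : Set V}
    (hwf : WellFounded (G.AdjOn S)) : ∃ l, G.IsTopOrder S l := by
  classical
  have := Fintype.ofFinite V
  have key : ∀ F : Finset V, ∃ l : List V, l.Nodup ∧ (∀ v, v ∈ l ↔ v ∈ F) ∧
      l.Pairwise fun a b => ¬ G.AdjOn S b a := by
    intro F
    induction hn : F.card generalizing F with
    | zero => exact ⟨[], by simp [Finset.card_eq_zero.1 hn]⟩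
    | succ n ih =>
      obtain ⟨m, hm, hmin⟩ := hwf.has_min (F : Set V)
        (Finset.coe_nonempty.2 (Finset.card_pos.1 (by omega)))
      obtain ⟨l, h1, h2, h3⟩ := ih (F.erase m) (by rw [Finset.card_erase_of_mem hm]; omega)
      refine ⟨m :: l, List.nodup_cons.2 ⟨by simp [h2], h1⟩, fun v => ?_,
        List.pairwise_cons.2 ⟨fun b hb => hmin b (Finset.mem_of_mem_erase ((h2 b).1 hb)), h3⟩⟩
      rw [List.mem_cons, h2, Finset.mem_erase]
      by_cases hv : v = m
      · simp [hv, Finset.mem_coe.1 hm]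
      · simp [hv]
  obtain ⟨l, h1, h2, h3⟩ := key (Finset.univ.filter (· ∈ S))
  have hmem : ∀ v, v ∈ l ↔ v ∈ S := by simp [h2]
  refine ⟨l, h1, hmem, fun x hx y hy hxy => ?_⟩
  exact before_of_pairwise h3 ((hmem x).2 hx) ((hmem y).2 hy)
    (by rintro rfl; exact hG _ hxy) ⟨hxy, hx, hy⟩

/-- With its converse below, this turns the two topological orders into a single linear extension of
`Precedes`, the form the greedy sort produces. -/
theorem pairwise_precedes_append {R : Set V} {l l' : List V} (h : G.IsTopOrder R l)
    (h' : G.IsTopOrder Rᶜ l') : (l ++ l'.reverse).Pairwise fun a b => ¬ G.Precedes R b a := by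
  refine List.pairwise_append.2 ⟨?_, List.pairwise_reverse.2 ?_, ?_⟩
  · refine h.pairwise.imp_of_mem fun ha hb hab => ?_
    have ha := (h.2.1 _).1 ha
    have hb := (h.2.1 _).1 hb
    unfold Precedes; tauto
  · refine h'.pairwise.imp_of_mem fun ha hb hab => ?_
    have ha : _ ∉ R := (h'.2.1 _).1 ha
    have hb : _ ∉ R := (h'.2.1 _).1 hb
    unfold Precedes; tauto
  · intro a ha b hb
    have ha := (h.2.1 _).1 ha
    have hb : _ ∉ R := (h'.2.1 _).1 (List.mem_reverse.1 hb)
    unfold Precedes; tauto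

theorem isVertexOrder_append {R : Set V} {l l' : List V} (h : G.IsTopOrder R l)
    (h' : G.IsTopOrder Rᶜ l') : IsVertexOrder (l ++ l'.reverse) := by
  refine ⟨List.nodup_append.2 ⟨h.1, List.nodup_reverse.2 h'.1, ?_⟩, fun v => ?_⟩
  · rintro a ha b hb rfl
    exact (h'.2.1 a).1 (List.mem_reverse.1 hb) ((h.2.1 a).1 ha)
  · rw [List.mem_append, List.mem_reverse, h.2.1, h'.2.1]
    exact em _

theorem isStandardLROrder_of_pairwise (hG : G.IsSimple) {R : Set V} {l : List V}
    (hl : IsVertexOrder l) (h : l.Pairwise fun a b => ¬ G.Precedes R b a) :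
    G.IsStandardLROrder R Rᶜ l := by
  have hb : ∀ x y, G.Precedes R x y → Before l x y := fun x y hxy =>
    before_of_pairwise h (hl.2 x) (hl.2 y) (hxy.ne hG) hxy
  refine ⟨hl, isCompl_compl, fun v hv w hvw => hb v w ?_, fun v hv w hvw => hb w v ?_,
    fun v hv w hw => hb v w (Or.inl ⟨hv, hw⟩)⟩
  · by_cases hw : w ∈ R
    · exact Or.inr (Or.inl ⟨hv, hw, hvw⟩)
    · exact Or.inl ⟨hv, hw⟩
  · by_cases hw : w ∈ R
    · exact Or.inl ⟨hw, hv⟩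
    · exact Or.inr (Or.inr ⟨hw, hv, hvw⟩)

theorem IsStandardLROrder.isLROrder {R L : Set V} {l : List V}
    (h : G.IsStandardLROrder R L l) : G.IsLROrder l := by
  refine ⟨h.1, fun v => ?_⟩
  rcases h.2.1.sup_eq_top.ge (Set.mem_univ v) with hv | hv
  · exact Or.inr (h.2.2.1 v hv)
  · exact Or.inl (h.2.2.2.1 v hv)

-- Each part inherits its order from `U`, and `U` is the concatenation because no element of `R` can
-- follow one outside `R`.
open Classical in
theorem exists_isTopOrder_append_of_pairwise (hG : G.IsSimple) {R : Set V} {U : List V}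
    (hU : IsVertexOrder U) (h : U.Pairwise fun a b => ¬ G.Precedes R b a) :
    ∃ l l', G.IsTopOrder R l ∧ G.IsTopOrder Rᶜ l' ∧ U = l ++ l'.reverse := by
  have hmem : ∀ v, v ∈ U.filter (· ∈ R) ↔ v ∈ R := by simp [hU.2]
  have hmem' : ∀ v, v ∈ (U.filter (· ∉ R)).reverse ↔ v ∈ Rᶜ := by simp [hU.2]
  refine ⟨U.filter (· ∈ R), (U.filter (· ∉ R)).reverse, ⟨hU.1.filter _, hmem, ?_⟩,
    ⟨List.nodup_reverse.2 (hU.1.filter _), hmem', ?_⟩, ?_⟩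
  · intro x hx y hy hxy
    refine before_of_pairwise (h.filter _) ((hmem x).2 hx) ((hmem y).2 hy) ?_
      (Or.inr (Or.inl ⟨hx, hy, hxy⟩))
    rintro rfl; exact hG _ hxy
  · intro x hx y hy hxy
    refine before_of_pairwise (r := fun a b => G.Precedes R b a)
      (List.pairwise_reverse.2 (h.filter _)) ((hmem' x).2 hx) ((hmem' y).2 hy) ?_
      (Or.inr (Or.inr ⟨hy, hx, hxy⟩))
    rintro rfl; exact hG _ hxy
  · rw [List.reverse_reverse]
    have key : ∀ l : List V, l.Pairwise (fun a b => ¬ G.Precedes R b a) →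
        l = l.filter (· ∈ R) ++ l.filter (· ∉ R) := by
      intro l hl
      induction l with
      | nil => rfl
      | cons a l ih =>
        have hl' := List.pairwise_cons.1 hl
        by_cases ha : a ∈ R
        · simpa [ha] using ih hl'.2
        -- From the first vertex outside `R` onward, nothing belongs to `R`.
        · have hnot : ∀ b ∈ l, b ∉ R := fun b hb hbR => hl'.1 b hb (Or.inl ⟨hbR, ha⟩)
          have h1 : l.filter (· ∈ R) = [] := by simpa using hnot
          have h2 : l.filter (fun x => !decide (x ∈ R)) = l := by simpa using hnot
          simp [ha, h1, h2]
    exact key U h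

/-! ### The partition of the boxes -/

/-- By nesting, the loops around `v` are the loop of its innermost head `w` and the loops around
`w`, so the depth grows by exactly one. -/
theorem isHeadColoring_odd [Finite V] (hG : G.IsFlowGraph s) (T : DFST G s) :
    G.IsHeadColoring s {v | Odd {u | G.InLoop s u v}.ncard} := by
  intro w v h
  have : {u | G.InLoop s u v} = insert w {u | G.InLoop s u w} := by
    ext u
    constructor
    · intro hu
      by_cases huw : u = w
      · exact Or.inl huw
      · exact Or.inr ((inLoop_or_inLoop hG T hu h.1 huw).resolve_right (h.2 u hu))
    · rintro (rfl | hu)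
      · exact h.1
      · exact InLoop.trans hG T hu h.1
  simp only [Set.mem_ofPred_eq, this]
  rw [Set.ncard_insert_of_notMem (fun h' => h'.1 rfl), Nat.odd_add_one]

namespace DFST

theorem exists_box [Finite V] (hG : G.IsReducible s) (T : DFST G s) (v : V) :
    ∃ X ∈ T.boxes, v ∈ X := by
  by_cases hv : v ∈ T.W
  · exact ⟨{v}, ⟨v, hv, Or.inl rfl⟩, rfl⟩
  · obtain ⟨w, hw⟩ := exists_isInnermost hG.1 T (v := v) (fun e => hv (Or.inr e))
    have hm : v ∈ T.pStar w \ T.W := ⟨(mem_pStar hG T w v).2 hw, hv⟩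
    exact ⟨_, ⟨w, mem_W_of_inLoop hG.1 T hw.1, Or.inr ⟨rfl, v, hm⟩⟩, hm⟩

/-- Singleton boxes lie in `W`, the others outside it, and a vertex has only one innermost head. -/
theorem box_unique [Finite V] (hG : G.IsReducible s) (T : DFST G s) {X Y : Set V} {v : V}
    (hX : X ∈ T.boxes) (hY : Y ∈ T.boxes) (hvX : v ∈ X) (hvY : v ∈ Y) : X = Y := by
  obtain ⟨w, hw, rfl | ⟨rfl, -⟩⟩ := hX <;> obtain ⟨w', hw', rfl | ⟨rfl, -⟩⟩ := hY
  · rw [← Set.mem_singleton_iff.1 hvX, ← Set.mem_singleton_iff.1 hvY]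
  · exact absurd (Set.mem_singleton_iff.1 hvX ▸ hw) hvY.2
  · exact absurd (Set.mem_singleton_iff.1 hvY ▸ hw') hvX.2
  · rw [((mem_pStar hG T w v).1 hvX.1).unique hG.1 T ((mem_pStar hG T w' v).1 hvY.1)]

/-- Translates the tree of innermost heads into the graph on the boxes. -/
theorem exists_boxEdge [Finite V] (hG : G.IsReducible s) (T : DFST G s) {w v : V}
    (h : G.IsInnermost s w v) : {w} ∈ T.boxes ∧ ∃ Y ∈ T.boxes, v ∈ Y ∧ T.BoxEdge {w} Y := by
  have hw := mem_W_of_inLoop hG.1 T h.1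
  have hv := (mem_pStar hG T w v).2 h
  refine ⟨⟨w, hw, Or.inl rfl⟩, ?_⟩
  by_cases hvW : v ∈ T.W
  · exact ⟨{v}, ⟨v, hvW, Or.inl rfl⟩, rfl, w, hw, rfl, Or.inr ⟨v, ⟨hvW, hv⟩, rfl⟩⟩
  · exact ⟨T.pStar w \ T.W, ⟨w, hw, Or.inr ⟨rfl, v, hv, hvW⟩⟩, ⟨hv, hvW⟩, w, hw, rfl,
      Or.inl ⟨rfl, v, hv, hvW⟩⟩

theorem LROutput.spec [Finite V] (hG : G.IsReducible s) {T : DFST G s} {R L : Set V}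
    {U : List V} (h : T.LROutput R L U) :
    L = Rᶜ ∧ G.IsHeadColoring s R ∧ G.IsStandardLROrder R L U := by
  obtain ⟨-, R', L', hbox, hdisj, hR', hL', rfl, rfl, l, l', hl, hl', rfl⟩ := h
  have hR'b : ∀ X ∈ R', X ∈ T.boxes := fun X hX => hbox ▸ Or.inl hX
  have hL'b : ∀ X ∈ L', X ∈ T.boxes := fun X hX => hbox ▸ Or.inr hX
  -- Because boxes are disjoint, the colour of a vertex is the colour of its box.
  have hmR : ∀ X ∈ T.boxes, ∀ x ∈ X, ((∃ Y ∈ R', x ∈ Y) ↔ X ∈ R') := fun X hX x hx =>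
    ⟨fun ⟨Y, hY, hxY⟩ => box_unique hG T (hR'b Y hY) hX hxY hx ▸ hY, fun h => ⟨X, h, hx⟩⟩
  have hmL : ∀ X ∈ T.boxes, ∀ x ∈ X, ((∃ Y ∈ L', x ∈ Y) ↔ X ∈ L') := fun X hX x hx =>
    ⟨fun ⟨Y, hY, hxY⟩ => box_unique hG T (hL'b Y hY) hX hxY hx ▸ hY, fun h => ⟨X, h, hx⟩⟩
  have hiff : ∀ X ∈ T.boxes, (X ∈ L' ↔ X ∉ R') := fun X hX =>
    ⟨fun h1 h2 => Set.disjoint_left.1 hdisj h2 h1, fun h1 => (hbox ▸ hX : X ∈ R' ∪ L').resolve_left h1⟩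
  have hcompl : {x | ∃ X ∈ L', x ∈ X} = {x | ∃ X ∈ R', x ∈ X}ᶜ := by
    ext x
    obtain ⟨X, hX, hx⟩ := exists_box hG T x
    simp only [Set.mem_compl_iff, Set.mem_ofPred_eq]
    rw [hmR X hX x hx, hmL X hX x hx, hiff X hX]
  refine ⟨hcompl, fun w v hwv => ?_, ?_⟩
  · obtain ⟨hw, Y, hY, hvY, he⟩ := exists_boxEdge hG T hwv
    simp only [Set.mem_ofPred_eq]
    rw [hmR Y hY v hvY, hmR {w} hw w rfl]
    refine ⟨fun h1 h2 => hR' _ h2 _ h1 he, fun h1 => ?_⟩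
    by_contra h2
    exact hL' _ ((hiff _ hw).2 h1) _ ((hiff _ hY).2 h2) he
  · rw [hcompl] at hl' ⊢
    exact isStandardLROrder_of_pairwise hG.1.1 (isVertexOrder_append hl hl')
      (pairwise_precedes_append hl hl')

theorem lrOutput_of_isTopOrder [Finite V] (hG : G.IsReducible s) (T : DFST G s) {R : Set V}
    (hR : G.IsHeadColoring s R) {l l' : List V} (hl : G.IsTopOrder R l)
    (hl' : G.IsTopOrder Rᶜ l') : T.LROutput R Rᶜ (l ++ l'.reverse) := by
  -- Boxes are monochromatic: all vertices of `P*(w) \ W` have the colour opposite to that of `w`.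
  have hmono : ∀ X ∈ T.boxes, ∀ x ∈ X, (x ∈ R ↔ X ⊆ R) := by
    rintro X ⟨w, hw, rfl | ⟨rfl, -⟩⟩ x hx
    · rw [Set.singleton_subset_iff, Set.mem_singleton_iff.1 hx]
    · refine ⟨fun hxR y hy => ?_, fun h => h hx⟩
      rw [hR w y ((mem_pStar hG T w y).1 hy.1)]
      rwa [hR w x ((mem_pStar hG T w x).1 hx.1)] at hxR
  have hedge : ∀ X Y, T.BoxEdge X Y → (Y ⊆ R ↔ ¬ X ⊆ R) := by
    rintro X Y ⟨w, hw, rfl, ⟨rfl, y, hy⟩ | ⟨w', hw', rfl⟩⟩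
    · rw [Set.singleton_subset_iff, ← hR w y ((mem_pStar hG T w y).1 hy.1),
        ← hmono _ ⟨w, hw, Or.inr ⟨rfl, y, hy⟩⟩ y hy]
    · rw [Set.singleton_subset_iff, Set.singleton_subset_iff,
        ← hR w w' ((mem_pStar hG T w w').1 hw'.2)]
  refine ⟨answersYes hG T, {X | X ∈ T.boxes ∧ X ⊆ R}, {X | X ∈ T.boxes ∧ ¬ X ⊆ R}, ?_, ?_,
    fun X hX Y hY he => (hedge X Y he).1 hY.2 hX.2, fun X hX Y hY he => hY.2 ((hedge X Y he).2 hX.2),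
    ?_, ?_, l, l', hl, hl', rfl⟩
  · ext X
    simp only [Set.mem_union, Set.mem_ofPred_eq]
    tauto
  · exact Set.disjoint_left.2 fun X h1 h2 => h2.2 h1.2
  · ext x
    obtain ⟨X, hX, hx⟩ := exists_box hG T x
    refine ⟨fun h => ⟨X, ⟨hX, (hmono X hX x hx).1 h⟩, hx⟩, ?_⟩
    rintro ⟨Y, ⟨-, hY⟩, hxY⟩
    exact hY hxY
  · ext x
    obtain ⟨X, hX, hx⟩ := exists_box hG T x
    refine ⟨fun h => ⟨X, ⟨hX, fun h' => h (h' hx)⟩, hx⟩, ?_⟩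
    rintro ⟨Y, ⟨hYb, hY⟩, hxY⟩ hxR
    exact hY ((hmono Y hYb x hxY).1 hxR)

end DFST

/-! ### From colourings to results of the algorithm and acyclic feedback vertex sets. -/

theorem IsHeadColoring.exists_lrOutput [Finite V] (hG : G.IsReducible s) (T : DFST G s)
    {R : Set V} (hR : G.IsHeadColoring s R) : ∃ U, T.LROutput R Rᶜ U := by
  obtain ⟨l, hl⟩ := exists_isTopOrder hG.1.1 (hR.left.wellFounded hG)
  obtain ⟨l', hl'⟩ := exists_isTopOrder hG.1.1 (hR.right.wellFounded hG)
  exact ⟨_, DFST.lrOutput_of_isTopOrder hG T hR hl hl'⟩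

theorem IsHeadColoring.isAcyclicFVS [Finite V] (hG : G.IsReducible s) {R : Set V}
    (hR : G.IsHeadColoring s R) (hne : R ≠ Set.univ) : G.IsAcyclicFVS R :=
  isAcyclicFVS_of_acyclicOn hne (hR.left.acyclicOn hG) (hR.right.acyclicOn hG)

theorem IsHeadColoring.isAcyclicFVS_compl [Finite V] (hG : G.IsReducible s) {R : Set V}
    (hR : G.IsHeadColoring s R) (hne : Rᶜ ≠ Set.univ) : G.IsAcyclicFVS Rᶜ :=
  isAcyclicFVS_of_acyclicOn hne (hR.right.acyclicOn hG)
    (by rw [compl_compl]; exact hR.left.acyclicOn hG)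

/-- A vertex other than `s` and its innermost head have different colours, so both classes are
non-empty. -/
theorem IsHeadColoring.ne_univ [Finite V] [Nontrivial V] (hG : G.IsFlowGraph s) (T : DFST G s)
    {R : Set V} (hR : G.IsHeadColoring s R) : R ≠ Set.univ ∧ Rᶜ ≠ Set.univ := by
  obtain ⟨v, hv⟩ := exists_ne s
  obtain ⟨w, hw⟩ := exists_isInnermost hG T hv
  have h := hR w v hw
  constructor
  · rintro rfl; simp at h
  · intro e
    rw [Set.compl_univ_iff] at e
    subst e; simp at h

theorem IsReducible.lr_ordering [Finite V] (hG : G.IsReducible s) (T : DFST G s) :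
    (∃ R L U, T.LROutput R L U) ∧
      ∀ R L U, T.LROutput R L U →
        G.IsLROrder U ∧ G.IsStandardLROrder R L U ∧ G.AcyclicOn R ∧ G.AcyclicOn L ∧
          (Nontrivial V → G.IsAcyclicFVS R ∧ G.IsAcyclicFVS L) := by
  refine ⟨?_, fun R L U h => ?_⟩
  · obtain ⟨U, hU⟩ := (isHeadColoring_odd hG.1 T).exists_lrOutput hG T
    exact ⟨_, _, U, hU⟩
  · obtain ⟨rfl, hR, hst⟩ := h.spec hG
    refine ⟨hst.isLROrder, hst, hR.left.acyclicOn hG, hR.right.acyclicOn hG, fun _ => ?_⟩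
    have := hR.ne_univ hG.1 T
    exact ⟨hR.isAcyclicFVS hG this.1, hR.isAcyclicFVS_compl hG this.2⟩

/-- The root has depth zero. This makes the odd class a proper subset even when `s` is the only
vertex. -/
theorem root_notMem_odd (hG : G.IsFlowGraph s) (T : DFST G s) :
    s ∉ {v | Odd {u | G.InLoop s u v}.ncard} := by
  have : {u | G.InLoop s u s} = ∅ := Set.eq_empty_of_forall_notMem (not_inLoop_root hG T)
  simp [this]

theorem IsReducible.exists_isAcyclicFVS [Finite V] (hG : G.IsReducible s) :
    ∃ S : Set V, G.IsAcyclicFVS S ∧ G.AcyclicOn Sᶜ := by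
  obtain ⟨T⟩ := nonempty_dfst G s
  have hR := isHeadColoring_odd hG.1 T
  refine ⟨_, hR.isAcyclicFVS hG fun e => root_notMem_odd hG.1 T ?_, hR.right.acyclicOn hG⟩
  rw [e]; trivial

/-- Among the vertices that are not in `D`, some vertex has all the vertices that have to precede
it in `D`. -/
theorem IsHeadColoring.exists_ready [Finite V] (hG : G.IsReducible s) {R : Set V}
    (hR : G.IsHeadColoring s R) {D : Set V} (hD : ∃ x, x ∉ D) :
    ∃ x, x ∉ D ∧ ∀ y, G.Precedes R y x → y ∈ D := by
  -- While vertices of `R` remain, a source among them is ready; after that, a sink among the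
  -- remaining vertices of the left part.
  by_cases h : ∃ x, x ∉ D ∧ x ∈ R
  · obtain ⟨x, ⟨hxD, hxR⟩, hmin⟩ := (hR.left.wellFounded hG).has_min {x | x ∉ D ∧ x ∈ R} h
    refine ⟨x, hxD, fun y hy => ?_⟩
    by_contra hyD
    rcases hy with hy | hy | hy
    · exact hy.2 hxR
    · exact hmin y ⟨hyD, hy.1⟩ ⟨hy.2.2, hy.1, hy.2.1⟩
    · exact hy.2.1 hxR
  · push Not at h
    obtain ⟨x, hxD, hmin⟩ := (hR.right.wellFounded_swap hG).has_min {x | x ∉ D} hD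
    refine ⟨x, hxD, fun y hy => ?_⟩
    by_contra hyD
    rcases hy with hy | hy | hy
    · exact h y hyD hy.1
    · exact h y hyD hy.1
    · exact hmin y hyD ⟨hy.2.2, hy.2.1, hy.1⟩

end

end Digraph

namespace Ram

/-! ### Execution of programs -/

/-- The final memory of a program. -/
def run (c : Cmd) (σ : State) : State :=
  (exec c σ).1

@[simp] theorem State.setVar_var (σ : State) (x v y : ℕ) :
    (σ.setVar x v).var y = if y = x then v else σ.var y := rfl

@[simp] theorem State.setVar_arr (σ : State) (x v : ℕ) : (σ.setVar x v).arr = σ.arr := rfl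

@[simp] theorem State.setArr_var (σ : State) (a i j v : ℕ) : (σ.setArr a i j v).var = σ.var := rfl

@[simp] theorem State.setArr_arr (σ : State) (a i j v b k l : ℕ) :
    (σ.setArr a i j v).arr b k l = if b = a ∧ k = i ∧ l = j then v else σ.arr b k l := rfl

@[simp] theorem run_skip (σ : State) : run .skip σ = σ := rfl

@[simp] theorem run_zero (x : ℕ) (σ : State) : run (.zero x) σ = σ.setVar x 0 := rfl

@[simp] theorem run_copy (x y : ℕ) (σ : State) : run (.copy x y) σ = σ.setVar x (σ.var y) := rfl

@[simp] theorem run_succ (x y : ℕ) (σ : State) :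
    run (.succ x y) σ = σ.setVar x (σ.var y + 1) := rfl

@[simp] theorem run_load (x a i j : ℕ) (σ : State) :
    run (.load x a i j) σ = σ.setVar x (σ.arr a (σ.var i) (σ.var j)) := rfl

@[simp] theorem run_store (a i j x : ℕ) (σ : State) :
    run (.store a i j x) σ = σ.setArr a (σ.var i) (σ.var j) (σ.var x) := rfl

@[simp] theorem run_seq (c d : Cmd) (σ : State) : run (.seq c d) σ = run d (run c σ) := rfl

@[simp] theorem run_ifEq (x y : ℕ) (c d : Cmd) (σ : State) :
    run (.ifEq x y c d) σ = if σ.var x = σ.var y then run c σ else run d σ := by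
  simp only [run, exec]; split <;> rfl

@[simp] theorem run_ifLt (x y : ℕ) (c d : Cmd) (σ : State) :
    run (.ifLt x y c d) σ = if σ.var x < σ.var y then run c σ else run d σ := by
  simp only [run, exec]; split <;> rfl

/-- The invariant sees memory and step count together, so that it serves both correctness and
running time. -/
theorem exec_loop_induction {x y : ℕ} {c : Cmd} {σ : State} (P : ℕ → State × ℕ → Prop)
    (h0 : P 0 (σ, 1))
    (hs : ∀ i p, i < σ.var y → P i p →
      P (i + 1) (run c (p.1.setVar x i), p.2 + (exec c (p.1.setVar x i)).2 + 1)) :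
    P (σ.var y) (exec (.loop x y c) σ) := by
  have key : ∀ m ≤ σ.var y, P m ((List.range m).foldl
      (fun p i => ((exec c (p.1.setVar x i)).1, p.2 + (exec c (p.1.setVar x i)).2 + 1))
      (σ, 1)) := by
    intro m
    induction m with
    | zero => exact fun _ => h0
    | succ m ih =>
      intro hm
      rw [List.range_succ, List.foldl_append]
      exact hs m _ hm (ih (Nat.le_of_succ_le hm))
  exact key _ le_rfl

/-- The variables that a program may change. -/
def Cmd.vars : Cmd → List ℕ
  | .skip => []
  | .zero x => [x]
  | .copy x _ => [x]
  | .succ x _ => [x]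
  | .load x _ _ _ => [x]
  | .store _ _ _ _ => []
  | .seq c d => c.vars ++ d.vars
  | .ifEq _ _ c d => c.vars ++ d.vars
  | .ifLt _ _ c d => c.vars ++ d.vars
  | .loop x _ c => x :: c.vars

/-- The arrays that a program may change. -/
def Cmd.arrs : Cmd → List ℕ
  | .store a _ _ _ => [a]
  | .seq c d => c.arrs ++ d.arrs
  | .ifEq _ _ c d => c.arrs ++ d.arrs
  | .ifLt _ _ c d => c.arrs ++ d.arrs
  | .loop _ _ c => c.arrs
  | _ => []

/-- The two memories agree but for the variables in `xs` and the arrays in `as`. -/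
def AgreeOff (xs as : List ℕ) (σ τ : State) : Prop :=
  (∀ x, x ∉ xs → τ.var x = σ.var x) ∧ ∀ a, a ∉ as → τ.arr a = σ.arr a

theorem AgreeOff.refl (xs as : List ℕ) (σ : State) : AgreeOff xs as σ σ :=
  ⟨fun _ _ => rfl, fun _ _ => rfl⟩

theorem AgreeOff.trans {xs as : List ℕ} {σ τ υ : State} (h : AgreeOff xs as σ τ)
    (h' : AgreeOff xs as τ υ) : AgreeOff xs as σ υ :=
  ⟨fun x hx => (h'.1 x hx).trans (h.1 x hx), fun a ha => (h'.2 a ha).trans (h.2 a ha)⟩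

theorem AgreeOff.mono {xs as xs' as' : List ℕ} {σ τ : State} (h : AgreeOff xs as σ τ)
    (hx : xs ⊆ xs') (ha : as ⊆ as') : AgreeOff xs' as' σ τ :=
  ⟨fun x h' => h.1 x fun h'' => h' (hx h''), fun a h' => h.2 a fun h'' => h' (ha h'')⟩

theorem AgreeOff.setVar {xs as : List ℕ} {σ τ : State} (h : AgreeOff xs as σ τ) {x v : ℕ}
    (hx : x ∈ xs) : AgreeOff xs as σ (τ.setVar x v) := by
  refine ⟨fun y hy => ?_, h.2⟩
  have : y ≠ x := by rintro rfl; exact hy hx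
  simp [this, h.1 y hy]

/-- The frame rule: for a concrete program the lists are computed, and what it leaves unchanged is
checked by `decide`. -/
theorem agreeOff_run (c : Cmd) : ∀ σ, AgreeOff c.vars c.arrs σ (run c σ) := by
  induction c with
  | skip => exact fun σ => .refl _ _ σ
  | zero x => exact fun σ => (AgreeOff.refl _ _ σ).setVar List.mem_cons_self
  | copy x y => exact fun σ => (AgreeOff.refl _ _ σ).setVar List.mem_cons_self
  | succ x y => exact fun σ => (AgreeOff.refl _ _ σ).setVar List.mem_cons_self
  | load x a i j => exact fun σ => (AgreeOff.refl _ _ σ).setVar List.mem_cons_self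
  | store a i j x =>
    refine fun σ => ⟨fun _ _ => rfl, fun b hb => ?_⟩
    have : b ≠ a := by rintro rfl; exact hb List.mem_cons_self
    funext k l
    simp [this]
  | seq c d ihc ihd =>
    exact fun σ => ((ihc σ).mono (List.subset_append_left _ _) (List.subset_append_left _ _)).trans
      ((ihd _).mono (List.subset_append_right _ _) (List.subset_append_right _ _))
  | ifEq x y c d ihc ihd =>
    intro σ
    rw [run_ifEq]
    split
    · exact (ihc σ).mono (List.subset_append_left _ _) (List.subset_append_left _ _)
    · exact (ihd σ).mono (List.subset_append_right _ _) (List.subset_append_right _ _)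
  | ifLt x y c d ihc ihd =>
    intro σ
    rw [run_ifLt]
    split
    · exact (ihc σ).mono (List.subset_append_left _ _) (List.subset_append_left _ _)
    · exact (ihd σ).mono (List.subset_append_right _ _) (List.subset_append_right _ _)
  | loop x y c ih =>
    intro σ
    refine exec_loop_induction (fun _ p => AgreeOff (x :: c.vars) c.arrs σ p.1) (.refl _ _ σ) ?_
    intro i p _ hp
    exact (hp.setVar List.mem_cons_self).trans
      ((ih _).mono (List.subset_cons_self _ _) (List.Subset.refl _))

/-- An invariant of a loop; the parts of the memory that the loop does not touch are constant. -/
theorem run_loop_induction {x y : ℕ} {c : Cmd} {σ : State} (P : ℕ → State → Prop)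
    (h0 : P 0 σ)
    (hs : ∀ i τ, i < σ.var y → AgreeOff (x :: c.vars) c.arrs σ τ → P i τ →
      P (i + 1) (run c (τ.setVar x i))) :
    P (σ.var y) (run (.loop x y c) σ) := by
  refine (exec_loop_induction (fun i p => AgreeOff (x :: c.vars) c.arrs σ p.1 ∧ P i p.1)
    ⟨.refl _ _ σ, h0⟩ ?_).2
  rintro i p hi ⟨hp, hP⟩
  exact ⟨(hp.setVar List.mem_cons_self).trans
    ((agreeOff_run c _).mono (List.subset_cons_self _ _) (List.Subset.refl _)), hs i _ hi hp hP⟩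

/-! ### Running times -/

/-- All loops of the program run up to the variable `y`. -/
def Cmd.LoopsTo (y : ℕ) : Cmd → Prop
  | .seq c d => c.LoopsTo y ∧ d.LoopsTo y
  | .ifEq _ _ c d => c.LoopsTo y ∧ d.LoopsTo y
  | .ifLt _ _ c d => c.LoopsTo y ∧ d.LoopsTo y
  | .loop _ z c => z = y ∧ c.LoopsTo y
  | _ => True

/-- A bound for the running time of a program all of whose loops have `X` rounds. -/
noncomputable def Cmd.cost : Cmd → Polynomial ℕ
  | .seq c d => c.cost + d.cost
  | .ifEq _ _ c d => c.cost + d.cost + 1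
  | .ifLt _ _ c d => c.cost + d.cost + 1
  | .loop _ _ c => Polynomial.X * (c.cost + 1) + 1
  | _ => 1

/-- Since `y` is never written, all loops, however nested, have the same number of rounds, and costs
compose as polynomials in it. -/
theorem exec_time_le (y : ℕ) (c : Cmd) : y ∉ c.vars → c.LoopsTo y → ∀ σ,
    (exec c σ).2 ≤ c.cost.eval (σ.var y) := by
  induction c with
  | skip | zero | copy | succ | load | store =>
    intro _ _ σ; simp [exec, Cmd.cost]
  | seq c d ihc ihd =>
    intro hy hl σ
    simp only [Cmd.vars, List.mem_append, not_or] at hy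
    have h1 := ihc hy.1 hl.1 σ
    have h2 := ihd hy.2 hl.2 (run c σ)
    rw [(agreeOff_run c σ).1 y hy.1] at h2
    simp only [exec, Cmd.cost, Polynomial.eval_add]
    exact add_le_add h1 h2
  | ifEq x z c d ihc ihd | ifLt x z c d ihc ihd =>
    intro hy hl σ
    simp only [Cmd.vars, List.mem_append, not_or] at hy
    have h1 := ihc hy.1 hl.1 σ
    have h2 := ihd hy.2 hl.2 σ
    simp only [exec, Cmd.cost, Polynomial.eval_add, Polynomial.eval_one]
    split <;> dsimp only <;> omega
  | loop x z c ih =>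
    intro hy hl σ
    obtain ⟨rfl, hl⟩ := hl
    simp only [Cmd.vars, List.mem_cons, not_or] at hy
    simp only [Cmd.cost, Polynomial.eval_add, Polynomial.eval_one, Polynomial.eval_mul,
      Polynomial.eval_X]
    refine (exec_loop_induction (fun i p => p.1.var z = σ.var z ∧
      p.2 ≤ i * (c.cost.eval (σ.var z) + 1) + 1) ⟨rfl, by simp⟩ ?_).2
    rintro i p _ ⟨h1, h2⟩
    have hv : (p.1.setVar x i).var z = σ.var z := by simp [hy.1, h1]
    refine ⟨by rw [(agreeOff_run c _).1 z hy.2, hv], ?_⟩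
    have h3 := ih hy.2 hl (p.1.setVar x i)
    rw [hv] at h3
    rw [Nat.succ_mul]
    omega

/-! ### Filling a matrix -/

/-- Run `c` for all values of the variables `5` and `6` below that of the variable `0`. -/
def forAll (c : Cmd) : Cmd :=
  .loop 5 0 (.loop 6 0 c)

/-- Each call writes only its own entry, so entries filled earlier survive; `hv` protects the bound
and the outer counter. -/
theorem run_forAll {X : ℕ} {c : Cmd} {σ : State} (f : ℕ → ℕ → ℕ)
    (hv : 0 ∉ 5 :: 6 :: c.vars ∧ 5 ∉ 6 :: c.vars)
    (hc : ∀ τ i j, i < σ.var 0 → j < σ.var 0 → AgreeOff (5 :: 6 :: c.vars) c.arrs σ τ →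
      τ.var 5 = i → τ.var 6 = j →
      ∀ k l, (run c τ).arr X k l = if k = i ∧ l = j then f i j else τ.arr X k l) :
    ∀ i j, i < σ.var 0 → j < σ.var 0 → (run (forAll c) σ).arr X i j = f i j := by
  refine run_loop_induction (fun m τ => ∀ i j, i < m → j < σ.var 0 → τ.arr X i j = f i j)
    (by simp) ?_
  intro m τ hm hτ ih
  have h0 : (τ.setVar 5 m).var 0 = σ.var 0 := (hτ.setVar List.mem_cons_self).1 0 hv.1
  have := run_loop_induction (x := 6) (y := 0) (c := c) (σ := τ.setVar 5 m)
    (fun k υ => (∀ i j, i < m → j < σ.var 0 → υ.arr X i j = f i j) ∧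
      ∀ j, j < k → υ.arr X m j = f m j) ⟨ih, by simp⟩ (by
    rintro k υ hk hυ ⟨h1, h2⟩
    rw [h0] at hk
    have h5 : (υ.setVar 6 k).var 5 = m := by
      rw [(hυ.setVar List.mem_cons_self).1 5 hv.2]; simp
    have hag : AgreeOff (5 :: 6 :: c.vars) c.arrs σ (υ.setVar 6 k) :=
      (hτ.setVar List.mem_cons_self).trans ((hυ.setVar List.mem_cons_self).mono
        (List.subset_cons_self _ _) (List.Subset.refl _))
    have hrun := hc (υ.setVar 6 k) m k hm hk hag h5 (by simp)
    constructor
    · intro i j hi hj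
      rw [hrun, if_neg (by omega)]
      exact h1 i j hi hj
    · intro j hj
      rw [hrun]
      split
      · next h => rw [h.2]
      · next h => exact h2 j (by omega))
  rw [h0] at this
  intro i j hi hj
  rcases Nat.lt_succ_iff_lt_or_eq.1 hi with hi | rfl
  · exact this.1 i j hi hj
  · exact this.2 j hj

/-! ### Reachability -/

/-- Run `c` if the entry of the array is the value of the variable `2`. -/
def whenArr (a i j : ℕ) (c : Cmd) : Cmd :=
  .seq (.load 4 a i j) (.ifEq 4 2 c .skip)

/-- Run `c` unless the entry of the array is the value of the variable `2`. -/
def unlessArr (a i j : ℕ) (c : Cmd) : Cmd :=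
  .seq (.load 4 a i j) (.ifEq 4 2 .skip c)

/-- Follow the arc from the variable `7` to the variable `8` in the row given by the variable
`5`, unless it ends in that vertex. -/
def relax (E X : ℕ) : Cmd :=
  whenArr X 5 7 (whenArr E 7 8 (.ifEq 8 5 .skip (.store X 5 8 2)))

/-- Close each row `w` of the matrix `X` under the arcs of `E` that do not end in `w`. -/
def closeRows (E X : ℕ) : Cmd :=
  .loop 5 0 (.loop 6 0 (.loop 7 0 (.loop 8 0 (relax E X))))

theorem run_relax_arr (E X : ℕ) (τ : State) (h2 : τ.var 2 = 1) (i j : ℕ) :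
    (run (relax E X) τ).arr X i j =
      if (τ.arr X (τ.var 5) (τ.var 7) = 1 ∧ τ.arr E (τ.var 7) (τ.var 8) = 1 ∧
        τ.var 8 ≠ τ.var 5) ∧ i = τ.var 5 ∧ j = τ.var 8 then 1 else τ.arr X i j := by
  by_cases hX : τ.arr X (τ.var 5) (τ.var 7) = 1
  · by_cases hE : τ.arr E (τ.var 7) (τ.var 8) = 1
    · by_cases h8 : τ.var 8 = τ.var 5
      · simp [relax, whenArr, h2, hX, h8]
      · simp [relax, whenArr, h2, hX, hE, h8]
    · simp [relax, whenArr, h2, hX, hE]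
  · simp [relax, whenArr, h2, hX]

section

variable {n : ℕ}

/-- The set `C` expresses soundness: whatever contains the row and is closed under the permitted
arcs also contains the new row. The last conclusion is progress by one step along every permitted
arc. -/
theorem run_relax_round {E X : ℕ} (hEX : E ≠ X) {σ : State} (h0 : σ.var 0 = n)
    (h2 : σ.var 2 = 1) {w : Fin n} (h5 : σ.var 5 = w) {C : Fin n → Prop}
    (hS : ∀ b : Fin n, σ.arr X w b = 1 → C b)
    (hC : ∀ a b : Fin n, C a → σ.arr E a b = 1 → b ≠ w → C b) {τ : State}
    (hτ : τ = run (.loop 7 0 (.loop 8 0 (relax E X))) σ) :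
    (∀ i j, i ≠ (w : ℕ) → τ.arr X i j = σ.arr X i j) ∧
    (∀ b : Fin n, τ.arr X w b = 1 → C b) ∧
    (∀ b : Fin n, σ.arr X w b = 1 → τ.arr X w b = 1) ∧
    ∀ a b : Fin n, σ.arr X w a = 1 → σ.arr E a b = 1 → b ≠ w → τ.arr X w b = 1 := by
  have hvars : (relax E X).vars = [4, 4] := rfl
  have harrs : (relax E X).arrs = [X] := rfl
  let Good : State → Prop := fun υ =>
    (∀ i j, i ≠ (w : ℕ) → υ.arr X i j = σ.arr X i j) ∧
    (∀ b : Fin n, υ.arr X w b = 1 → C b) ∧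
    (∀ b : Fin n, σ.arr X w b = 1 → υ.arr X w b = 1)
  have main := run_loop_induction (x := 7) (y := 0) (c := .loop 8 0 (relax E X)) (σ := σ)
    (fun k υ => Good υ ∧ ∀ a b : Fin n, (a : ℕ) < k → σ.arr X w a = 1 → σ.arr E a b = 1 →
      b ≠ w → υ.arr X w b = 1) ⟨⟨fun _ _ _ => rfl, hS, fun _ h => h⟩, by simp⟩ (by
    rintro k υ hk hυ ⟨hg, hr⟩
    rw [h0] at hk
    have hυ' := hυ.setVar (x := 7) (v := k) List.mem_cons_self
    have hn : (υ.setVar 7 k).var 0 = n := by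
      rw [hυ'.1 0 (by simp [Cmd.vars, hvars]), h0]
    have inner := run_loop_induction (x := 8) (y := 0) (c := relax E X) (σ := υ.setVar 7 k)
      (fun l φ => Good φ ∧ (∀ a b : Fin n, (a : ℕ) < k → σ.arr X w a = 1 → σ.arr E a b = 1 →
        b ≠ w → φ.arr X w b = 1) ∧ ∀ b : Fin n, (b : ℕ) < l → σ.arr X w k = 1 →
        σ.arr E k b = 1 → b ≠ w → φ.arr X w b = 1) ⟨hg, hr, by simp⟩ (by
      rintro l φ hl hφ ⟨hg, hr, hs⟩
      rw [hn] at hl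
      have hφ' := hφ.setVar (x := 8) (v := l) List.mem_cons_self
      have e2 : (φ.setVar 8 l).var 2 = 1 := by
        rw [hφ'.1 2 (by simp [hvars]), hυ'.1 2 (by simp [Cmd.vars, hvars]), h2]
      have e5 : (φ.setVar 8 l).var 5 = w := by
        rw [hφ'.1 5 (by simp [hvars]), hυ'.1 5 (by simp [Cmd.vars, hvars]), h5]
      have e7 : (φ.setVar 8 l).var 7 = k := by
        rw [hφ'.1 7 (by simp [hvars])]; simp
      have e8 : (φ.setVar 8 l).var 8 = l := by simp
      have eE : (φ.setVar 8 l).arr E = σ.arr E := by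
        rw [hφ'.2 E (by simp [harrs, hEX]), hυ'.2 E (by simp [Cmd.arrs, harrs, hEX])]
      have hrun : ∀ i j, (run (relax E X) (φ.setVar 8 l)).arr X i j =
          if (φ.arr X w k = 1 ∧ σ.arr E k l = 1 ∧ l ≠ w) ∧ i = w ∧ j = l then 1
          else φ.arr X i j := by
        intro i j
        have := run_relax_arr E X (φ.setVar 8 l) e2 i j
        rw [e5, e7, e8, eE] at this
        exact this
      have hmono : ∀ b : Fin n, φ.arr X w b = 1 →
          (run (relax E X) (φ.setVar 8 l)).arr X w b = 1 := by
        intro b hb; rw [hrun]; split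
        · rfl
        · exact hb
      refine ⟨⟨fun i j hi => ?_, fun b hb => ?_, fun b hb => hmono b (hg.2.2 b hb)⟩,
        fun a b ha h1 h2 h3 => hmono b (hr a b ha h1 h2 h3), fun b hb h1 h2 h3 => ?_⟩
      · rw [hrun, if_neg (fun h => hi h.2.1)]; exact hg.1 i j hi
      · rw [hrun] at hb
        split at hb
        · next h =>
          obtain ⟨⟨h1, h2, h3⟩, -, h4⟩ := h
          refine hC ⟨k, hk⟩ b (hg.2.1 ⟨k, hk⟩ h1) (by rw [h4]; exact h2) ?_
          rintro rfl; exact h3 h4.symm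
        · exact hg.2.1 b hb
      · rcases Nat.lt_succ_iff_lt_or_eq.1 hb with hb | hb
        · exact hmono b (hs b hb h1 h2 h3)
        · rw [hrun, if_pos]
          refine ⟨⟨hg.2.2 ⟨k, hk⟩ h1, hb ▸ h2, fun e => h3 (Fin.ext (hb.trans e))⟩, rfl, hb⟩)
    rw [hn] at inner
    refine ⟨inner.1, fun a b ha h1 h2 h3 => ?_⟩
    rcases Nat.lt_succ_iff_lt_or_eq.1 ha with ha | rfl
    · exact inner.2.1 a b ha h1 h2 h3
    · exact inner.2.2 b b.2 h1 h2 h3)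
  rw [h0, ← hτ] at main
  exact ⟨main.1.1, main.1.2.1, main.1.2.2, fun a b => main.2 a b a.2⟩

/-- After `k` rounds the row is closed or has at least `k` marked entries, so `n` rounds suffice. -/
theorem run_relax_rounds {E X : ℕ} (hEX : E ≠ X) {σ : State} (h0 : σ.var 0 = n)
    (h2 : σ.var 2 = 1) {w : Fin n} (h5 : σ.var 5 = w) {τ : State}
    (hτ : τ = run (.loop 6 0 (.loop 7 0 (.loop 8 0 (relax E X)))) σ) :
    (∀ i j, i ≠ (w : ℕ) → τ.arr X i j = σ.arr X i j) ∧
    ∀ b : Fin n, τ.arr X w b = 1 ↔ ∃ a : Fin n, σ.arr X w a = 1 ∧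
      Relation.ReflTransGen (fun a b : Fin n => σ.arr E a b = 1 ∧ b ≠ w) a b := by
  classical
  have hvars : (relax E X).vars = [4, 4] := rfl
  have harrs : (relax E X).arrs = [X] := rfl
  let C : Fin n → Prop := fun b => ∃ a : Fin n, σ.arr X w a = 1 ∧
      Relation.ReflTransGen (fun a b : Fin n => σ.arr E a b = 1 ∧ b ≠ w) a b
  let S : State → Finset (Fin n) := fun υ => Finset.univ.filter fun b => υ.arr X w b = 1
  have main := run_loop_induction (x := 6) (y := 0) (c := .loop 7 0 (.loop 8 0 (relax E X)))
    (σ := σ) (fun k υ => (∀ i j, i ≠ (w : ℕ) → υ.arr X i j = σ.arr X i j) ∧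
      (∀ b : Fin n, υ.arr X w b = 1 → C b) ∧ (∀ b : Fin n, σ.arr X w b = 1 → υ.arr X w b = 1) ∧
      ((∀ a b : Fin n, υ.arr X w a = 1 → σ.arr E a b = 1 → b ≠ w → υ.arr X w b = 1) ∨
        k ≤ (S υ).card)) ⟨fun _ _ _ => rfl, fun b hb => ⟨b, hb, .refl⟩, fun _ h => h, by simp⟩ (by
    rintro k υ hk hυ ⟨hg1, hg2, hg3, hg4⟩
    have hυ' := hυ.setVar (x := 6) (v := k) List.mem_cons_self
    have eE : (υ.setVar 6 k).arr E = σ.arr E := hυ'.2 E (by simp [Cmd.arrs, harrs, hEX])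
    obtain ⟨r1, r2, r3, r4⟩ := run_relax_round hEX (σ := υ.setVar 6 k) (n := n) (w := w) (C := C)
      (by rw [hυ'.1 0 (by simp [Cmd.vars, hvars]), h0])
      (by rw [hυ'.1 2 (by simp [Cmd.vars, hvars]), h2])
      (by rw [hυ'.1 5 (by simp [Cmd.vars, hvars]), h5]) hg2
      (fun a b ⟨c, hc, hca⟩ hab hb => ⟨c, hc, hca.tail ⟨by rwa [eE] at hab, hb⟩⟩) rfl
    rw [eE] at r4
    refine ⟨fun i j hi => (r1 i j hi).trans (hg1 i j hi), r2, fun b hb => r3 b (hg3 b hb), ?_⟩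
    set φ := run (.loop 7 0 (.loop 8 0 (relax E X))) (υ.setVar 6 k)
    by_cases heq : ∀ b : Fin n, φ.arr X w b = 1 → υ.arr X w b = 1
    · exact Or.inl fun a b ha hab hb => r4 a b (heq a ha) hab hb
    · push Not at heq
      obtain ⟨b, hb, hb'⟩ := heq
      have hlt : (S υ).card < (S φ).card := by
        refine Finset.card_lt_card ((Finset.ssubset_iff_of_subset fun x hx => ?_).2
          ⟨b, by simp [S, hb], by simp [S, hb']⟩)
        simp only [S, Finset.mem_filter, Finset.mem_univ, true_and] at hx ⊢
        exact r3 x hx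
      -- A row that was already closed contains all of `C`, hence cannot have grown.
      rcases hg4 with hg4 | hg4
      · refine absurd ?_ hb'
        obtain ⟨a, ha, hab⟩ := r2 b hb
        clear hb hb'
        induction hab with
        | refl => exact hg3 _ ha
        | tail _ hbc ih => exact hg4 _ _ ih hbc.1 hbc.2
      · exact Or.inr (by omega))
  rw [h0, ← hτ] at main
  obtain ⟨m1, m2, m3, m4⟩ := main
  refine ⟨m1, fun b => ⟨m2 b, ?_⟩⟩
  rintro ⟨a, ha, hab⟩
  rcases m4 with m4 | m4
  · induction hab with
    | refl => exact m3 _ ha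
    | tail _ hbc ih => exact m4 _ _ ih hbc.1 hbc.2
  -- With `n` marked entries the row is full.
  · have : S τ = Finset.univ := by
      rw [← Finset.card_eq_iff_eq_univ, Fintype.card_fin]
      exact le_antisymm ((Finset.card_le_univ _).trans (Fintype.card_fin n).le) m4
    have hb : b ∈ S τ := this ▸ Finset.mem_univ b
    simpa [S] using hb

/-- Only the ends of arcs are kept away from `w`; the starting points are governed by the initial
contents of the row. -/
theorem run_closeRows {E X : ℕ} (hEX : E ≠ X) {σ : State} (h0 : σ.var 0 = n)
    (h2 : σ.var 2 = 1) (w b : Fin n) :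
    (run (closeRows E X) σ).arr X w b = 1 ↔ ∃ a : Fin n, σ.arr X w a = 1 ∧
      Relation.ReflTransGen (fun a b : Fin n => σ.arr E a b = 1 ∧ b ≠ w) a b := by
  have hvars : (relax E X).vars = [4, 4] := rfl
  have harrs : (relax E X).arrs = [X] := rfl
  have main := run_loop_induction (x := 5) (y := 0)
    (c := .loop 6 0 (.loop 7 0 (.loop 8 0 (relax E X)))) (σ := σ)
    (fun k υ => (∀ i j, k ≤ i → υ.arr X i j = σ.arr X i j) ∧
      ∀ w b : Fin n, (w : ℕ) < k → (υ.arr X w b = 1 ↔ ∃ a : Fin n, σ.arr X w a = 1 ∧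
      Relation.ReflTransGen (fun a b : Fin n => σ.arr E a b = 1 ∧ b ≠ w) a b))
    ⟨fun _ _ _ => rfl, by simp⟩ (by
    rintro k υ hk hυ ⟨hg1, hg2⟩
    rw [h0] at hk
    have hυ' := hυ.setVar (x := 5) (v := k) List.mem_cons_self
    have eE : (υ.setVar 5 k).arr E = σ.arr E := hυ'.2 E (by simp [Cmd.arrs, harrs, hEX])
    obtain ⟨r1, r2⟩ := run_relax_rounds hEX (σ := υ.setVar 5 k) (n := n) (w := ⟨k, hk⟩)
      (by rw [hυ'.1 0 (by simp [Cmd.vars, hvars]), h0])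
      (by rw [hυ'.1 2 (by simp [Cmd.vars, hvars]), h2]) (by simp) rfl
    rw [eE] at r2
    refine ⟨fun i j hi => ?_, fun w b hw => ?_⟩
    · rw [r1 i j (by simp; omega)]; exact hg1 i j (by omega)
    · rcases Nat.lt_succ_iff_lt_or_eq.1 hw with hw | rfl
      · rw [r1 w b (by simp; omega)]; exact hg2 w b hw
      · rw [r2 b]; simp only [State.setVar_arr, hg1 _ _ le_rfl])
  rw [h0] at main
  exact main.2 w b w.2

end

end Ram

namespace Ram

open Digraph

variable {n : ℕ}

/-! ### Innermost loops and the parity of the nesting depth -/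

/-- Treat the vertex in the variable `8` as a candidate for the innermost loop of the vertex in
the variable `5`: the variable `6` holds the innermost loop found so far, and the variable `7`
the parity of the number of loops found so far. -/
def headStep : Cmd :=
  whenArr 6 8 5 (.seq (.ifEq 7 3 (.copy 7 2) (.zero 7)) (whenArr 6 6 8 (.copy 6 8)))

/-- From the matrix of the loops, compute the innermost loops and the parities of the depths. -/
def computeHeads : Cmd :=
  .loop 5 0 (.seq (.copy 6 1) (.seq (.zero 7) (.seq (.loop 8 0 headStep)
    (.seq (.store 1 3 5 6) (.store 2 3 5 7)))))

theorem run_headStep_var (τ : State) (h2 : τ.var 2 = 1) (h3 : τ.var 3 = 0) :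
    (run headStep τ).var 6 = (if τ.arr 6 (τ.var 8) (τ.var 5) = 1 ∧
      τ.arr 6 (τ.var 6) (τ.var 8) = 1 then τ.var 8 else τ.var 6) ∧
    (run headStep τ).var 7 = if τ.arr 6 (τ.var 8) (τ.var 5) = 1 then
      (if τ.var 7 = 0 then 1 else 0) else τ.var 7 := by
  by_cases h1 : τ.arr 6 (τ.var 8) (τ.var 5) = 1
  · by_cases h7 : τ.var 7 = 0 <;> by_cases h6 : τ.arr 6 (τ.var 6) (τ.var 8) = 1 <;>
      simp [headStep, whenArr, h1, h2, h3, h6, h7]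
  · simp [headStep, whenArr, h1, h2]

/-- The candidate starts as `s` and moves only to the head of a deeper loop around `v`; no loop seen
so far is nested inside that of the candidate. -/
theorem run_loop_headStep {G : Digraph (Fin n)} {s : Fin n} (hG : G.IsFlowGraph s)
    (T : DFST G s) {σ : State} (h0 : σ.var 0 = n) (h2 : σ.var 2 = 1) (h3 : σ.var 3 = 0)
    (hl : ∀ u v : Fin n, σ.arr 6 u v = 1 ↔ G.InLoop s u v) {v : Fin n} (h5 : σ.var 5 = v)
    (h6 : σ.var 6 = s) (h7 : σ.var 7 = 0) {τ : State} (hτ : τ = run (.loop 8 0 headStep) σ) :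
    (∃ h : Fin n, τ.var 6 = h ∧ (v ≠ s → G.IsInnermost s h v)) ∧
      τ.var 7 = {u | G.InLoop s u v}.ncard % 2 := by
  classical
  have main := run_loop_induction (x := 8) (y := 0) (c := headStep) (σ := σ)
    (fun k υ => (∃ h : Fin n, υ.var 6 = h ∧ (v ≠ s → G.InLoop s h v ∧ ∀ u : Fin n,
      (u : ℕ) < k → G.InLoop s u v → ¬ G.InLoop s h u)) ∧
      υ.var 7 = Nat.count (fun u => σ.arr 6 u v = 1) k % 2)
    ⟨⟨s, h6, fun hv => ⟨⟨hv, Or.inl rfl⟩, by simp⟩⟩, by simp [h7]⟩ (by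
    rintro k υ hk hυ ⟨⟨h, hh, hv⟩, hc⟩
    rw [h0] at hk
    have hυ' := hυ.setVar (x := 8) (v := k) List.mem_cons_self
    obtain ⟨r6, r7⟩ := run_headStep_var (υ.setVar 8 k) (by rw [hυ'.1 2 (by decide), h2])
      (by rw [hυ'.1 3 (by decide), h3])
    have e6 : (υ.setVar 8 k).arr 6 = σ.arr 6 := hυ'.2 6 (by decide)
    have e5 : (υ.setVar 8 k).var 5 = v := by rw [hυ'.1 5 (by decide), h5]
    have e8 : (υ.setVar 8 k).var 8 = k := by simp
    have e6' : (υ.setVar 8 k).var 6 = h := by simp [hh]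
    have e7 : (υ.setVar 8 k).var 7 = υ.var 7 := by simp
    rw [e6, e5, e8, e6'] at r6
    rw [e6, e5, e8, e7] at r7
    have hk1 := hl ⟨k, hk⟩ v
    have hk2 := hl h ⟨k, hk⟩
    simp only at hk1 hk2
    constructor
    · by_cases hcase : σ.arr 6 k v = 1 ∧ σ.arr 6 h k = 1
      · refine ⟨⟨k, hk⟩, by rw [r6, if_pos hcase], fun hvs => ⟨hk1.1 hcase.1, ?_⟩⟩
        intro u hu huv hku
        rcases Nat.lt_succ_iff_lt_or_eq.1 hu with hu | hu
        -- A loop inside the new candidate's would also be inside the old one's, which the invariant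
        -- excludes.
        · exact (hv hvs).2 u hu huv (InLoop.trans hG T (hk2.1 hcase.2) hku)
        · obtain rfl : u = ⟨k, hk⟩ := Fin.ext hu
          exact hku.1 rfl
      · refine ⟨h, by rw [r6, if_neg hcase], fun hvs => ⟨(hv hvs).1, ?_⟩⟩
        intro u hu huv hhu
        rcases Nat.lt_succ_iff_lt_or_eq.1 hu with hu | hu
        · exact (hv hvs).2 u hu huv hhu
        · obtain rfl : u = ⟨k, hk⟩ := Fin.ext hu
          exact hcase ⟨hk1.2 huv, hk2.2 hhu⟩
    · rw [r7, Nat.count_succ, hc]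
      split
      · split <;> omega
      · rfl)
  rw [h0, ← hτ] at main
  obtain ⟨⟨h, hh, hv⟩, hc⟩ := main
  refine ⟨⟨h, hh, fun hvs => ⟨(hv hvs).1, fun u => (hv hvs).2 u u.2⟩⟩, ?_⟩
  -- The count over natural numbers below `n` is compared with the count over `Fin n` through the
  -- injection of values.
  rw [hc, Nat.count_eq_card_filter_range, ← Set.ncard_coe_finset,
    ← Set.ncard_image_of_injective _ Fin.val_injective]
  congr 2
  ext u
  simp only [Finset.coe_filter, Finset.mem_range, Set.mem_ofPred_eq, Set.mem_image]
  constructor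
  · rintro ⟨hu, h⟩
    exact ⟨⟨u, hu⟩, (hl ⟨u, hu⟩ v).1 h, rfl⟩
  · rintro ⟨u, hu, rfl⟩
    exact ⟨u.2, (hl u v).2 hu⟩

theorem run_computeHeads {G : Digraph (Fin n)} {s : Fin n} (hG : G.IsFlowGraph s)
    (T : DFST G s) {σ : State} (h0 : σ.var 0 = n) (h1 : σ.var 1 = s) (h2 : σ.var 2 = 1)
    (h3 : σ.var 3 = 0) (hl : ∀ u v : Fin n, σ.arr 6 u v = 1 ↔ G.InLoop s u v) (v : Fin n) :
    (∃ h : Fin n, (run computeHeads σ).arr 1 0 v = h ∧ (v ≠ s → G.IsInnermost s h v)) ∧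
      (run computeHeads σ).arr 2 0 v = {u | G.InLoop s u v}.ncard % 2 := by
  have main := run_loop_induction (x := 5) (y := 0)
    (c := .seq (.copy 6 1) (.seq (.zero 7) (.seq (.loop 8 0 headStep)
      (.seq (.store 1 3 5 6) (.store 2 3 5 7))))) (σ := σ)
    (fun k υ => ∀ v : Fin n, (v : ℕ) < k →
      (∃ h : Fin n, υ.arr 1 0 v = h ∧ (v ≠ s → G.IsInnermost s h v)) ∧
      υ.arr 2 0 v = {u | G.InLoop s u v}.ncard % 2) (by simp) (by
    intro k υ hk hυ hi v hv
    rw [h0] at hk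
    have hυ' := hυ.setVar (x := 5) (v := k) List.mem_cons_self
    set φ := ((υ.setVar 5 k).setVar 6 ((υ.setVar 5 k).var 1)).setVar 7 0 with hφ
    have hφ' : AgreeOff [5, 6, 7, 4, 4, 8] [1, 2] σ φ :=
      ((hυ'.mono (by decide) (by decide)).setVar (by decide)).setVar (by decide)
    have e6 : φ.arr 6 = σ.arr 6 := hφ'.2 6 (by decide)
    have hin := run_loop_headStep hG T (σ := φ) (v := ⟨k, hk⟩)
      (by rw [hφ'.1 0 (by decide), h0]) (by rw [hφ'.1 2 (by decide), h2])
      (by rw [hφ'.1 3 (by decide), h3]) (by rw [e6]; exact hl) (by simp [hφ])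
      (by simp only [hφ]; rw [hυ'.1 1 (by decide)]; simp [h1]) (by simp [hφ]) rfl
    have hag := agreeOff_run (.loop 8 0 headStep) φ
    simp only [run_seq, run_copy, run_zero, run_store, ← hφ]
    set ψ := run (.loop 8 0 headStep) φ
    have p3 : ψ.var 3 = 0 := by rw [hag.1 3 (by decide), hφ'.1 3 (by decide), h3]
    have p5 : ψ.var 5 = k := by rw [hag.1 5 (by decide)]; simp [hφ]
    have p1 : ψ.arr 1 = υ.arr 1 := hag.2 1 (by decide)
    have p2 : ψ.arr 2 = υ.arr 2 := hag.2 2 (by decide)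
    simp only [State.setArr_arr, State.setArr_var, p3, p5, p1, p2]
    rcases Nat.lt_succ_iff_lt_or_eq.1 hv with hv | hv
    · have : (v : ℕ) ≠ k := by omega
      simpa [this] using hi v hv
    · obtain rfl : v = ⟨k, hk⟩ := Fin.ext hv
      simpa using hin)
  rw [h0] at main
  exact main v v.2

/-! ### Greedy topological sorting -/

/-- Reset the variable `7` if some vertex that has to precede the vertex in the variable `6` has
not yet been listed. -/
def testReady : Cmd :=
  .loop 8 0 (whenArr 7 8 6 (unlessArr 8 3 8 (.zero 7)))

/-- List the vertex in the variable `6` if it is ready. -/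
def visit : Cmd :=
  unlessArr 8 3 6 (.seq (.copy 7 2) (.seq testReady (.ifEq 7 2
    (.seq (.store 3 3 9 6) (.seq (.store 8 3 6 2) (.succ 9 9))) .skip)))

theorem run_testReady {σ : State} (h0 : σ.var 0 = n) (h2 : σ.var 2 = 1) (h3 : σ.var 3 = 0)
    (h7 : σ.var 7 = 1) :
    (run testReady σ).var 7 = 1 ↔
      ∀ y : Fin n, σ.arr 7 y (σ.var 6) = 1 → σ.arr 8 0 y = 1 := by
  have main := run_loop_induction (x := 8) (y := 0)
    (c := whenArr 7 8 6 (unlessArr 8 3 8 (.zero 7))) (σ := σ)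
    (fun k υ => υ.var 7 = 1 ↔
      ∀ y : Fin n, (y : ℕ) < k → σ.arr 7 y (σ.var 6) = 1 → σ.arr 8 0 y = 1)
    (by simp [h7]) (by
    intro k υ hk hυ hi
    rw [h0] at hk
    have hυ' := hυ.setVar (x := 8) (v := k) List.mem_cons_self
    have e2 : υ.var 2 = 1 := by rw [hυ.1 2 (by decide), h2]
    have e3 : υ.var 3 = 0 := by rw [hυ.1 3 (by decide), h3]
    have e6 : υ.var 6 = σ.var 6 := hυ.1 6 (by decide)
    have e7 : υ.arr 7 = σ.arr 7 := hυ.2 7 (by decide)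
    have e8 : υ.arr 8 = σ.arr 8 := hυ.2 8 (by decide)
    have hsplit : (∀ y : Fin n, (y : ℕ) < k + 1 → σ.arr 7 y (σ.var 6) = 1 → σ.arr 8 0 y = 1) ↔
        (∀ y : Fin n, (y : ℕ) < k → σ.arr 7 y (σ.var 6) = 1 → σ.arr 8 0 y = 1) ∧
        (σ.arr 7 k (σ.var 6) = 1 → σ.arr 8 0 k = 1) := by
      refine ⟨fun h => ⟨fun y hy => h y (by omega), h ⟨k, hk⟩ (Nat.lt_succ_self k)⟩, ?_⟩
      rintro ⟨h, h'⟩ y hy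
      rcases Nat.lt_succ_iff_lt_or_eq.1 hy with hy | rfl
      · exact h y hy
      · exact h'
    rw [hsplit, ← hi]
    by_cases c1 : σ.arr 7 k (σ.var 6) = 1 <;> by_cases c2 : σ.arr 8 0 k = 1 <;>
      simp [whenArr, unlessArr, e2, e3, e6, e7, e8, c1, c2])
  rw [h0] at main
  exact main.trans ⟨fun h y => h y y.2, fun h y _ => h y⟩

/-- The vertices of `l` have been listed, in this order. -/
structure Listed (B : Fin n → Fin n → Prop) (l : List (Fin n)) (τ : State) : Prop where
  length : τ.var 9 = l.length
  seq : ∀ (k : ℕ) (hk : k < l.length), τ.arr 3 0 k = (l[k] : ℕ)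
  mem : ∀ x : Fin n, τ.arr 8 0 x = 1 ↔ x ∈ l
  nodup : l.Nodup
  closed : ∀ a ∈ l, ∀ y, B y a → y ∈ l
  pairwise : l.Pairwise fun a b => ¬ B b a

theorem Listed.congr {B : Fin n → Fin n → Prop} {l : List (Fin n)} {σ τ : State}
    (h : Listed B l σ) (h9 : τ.var 9 = σ.var 9) (h3 : τ.arr 3 = σ.arr 3)
    (h8 : τ.arr 8 = σ.arr 8) : Listed B l τ where
  length := by rw [h9, h.length]
  seq := by rw [h3]; exact h.seq
  mem := by rw [h8]; exact h.mem
  nodup := h.nodup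
  closed := h.closed
  pairwise := h.pairwise

/-- The list is closed under predecessors, so an unlisted `x` precedes none of its elements and may
be put last. -/
theorem Listed.append {B : Fin n → Fin n → Prop} {l : List (Fin n)} {τ : State}
    (h : Listed B l τ) {x : Fin n} (hx : x ∉ l) (hr : ∀ y, B y x → y ∈ l) :
    Listed B (l ++ [x]) (((τ.setArr 3 0 (τ.var 9) x).setArr 8 0 x 1).setVar 9 (τ.var 9 + 1)) where
  length := by simp [h.length]
  seq := by
    intro k hk
    simp only [State.setVar_arr, State.setArr_arr, h.length]
    rcases Nat.lt_or_ge k l.length with hlt | hge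
    · rw [List.getElem_append_left hlt, ← h.seq k hlt]
      simp [hlt.ne]
    · obtain rfl : k = l.length := by simp at hk; omega
      simp
  mem := by
    intro y
    by_cases hy : y = x
    · simp [hy]
    · have : (y : ℕ) ≠ x := fun e => hy (Fin.ext e)
      simp [hy, this, h.mem]
  nodup := by
    refine List.nodup_append.2 ⟨h.nodup, by simp, ?_⟩
    rintro a ha b hb rfl
    exact hx (List.mem_singleton.1 hb ▸ ha)
  closed := by
    intro a ha y hy
    rcases List.mem_append.1 ha with ha | ha
    · exact List.mem_append_left _ (h.closed a ha y hy)
    · rw [List.mem_singleton.1 ha] at hy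
      exact List.mem_append_left _ (hr y hy)
  pairwise := by
    refine List.pairwise_append.2 ⟨h.pairwise, by simp, fun a ha b hb hab => ?_⟩
    rw [List.mem_singleton.1 hb] at hab
    exact hx (h.closed a ha x hab)

theorem Listed.run_visit {B : Fin n → Fin n → Prop} {l : List (Fin n)} {τ : State}
    (h : Listed B l τ) (h0 : τ.var 0 = n) (h2 : τ.var 2 = 1) (h3 : τ.var 3 = 0)
    (hB : ∀ y x : Fin n, τ.arr 7 y x = 1 ↔ B y x) {x : Fin n} (h6 : τ.var 6 = x) :
    ∃ l', Listed B l' (run visit τ) ∧ l <+: l' ∧ ((∀ y, B y x → y ∈ l) → x ∈ l') := by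
  have hmem := h.mem x
  by_cases hx : x ∈ l
  · refine ⟨l, ?_, List.prefix_rfl, fun _ => hx⟩
    have := hmem.2 hx
    simp only [visit, unlessArr, run_seq, run_load, run_ifEq, h3, h6]
    rw [if_pos (by simp [this, h2])]
    exact h.congr (by simp) rfl rfl
  · have hne : τ.arr 8 0 x ≠ 1 := fun e => hx (hmem.1 e)
    simp only [visit, unlessArr, run_seq, run_load, run_ifEq, h3, h6]
    rw [if_neg (by simp [hne, h2])]
    set φ := run (.copy 7 2) (τ.setVar 4 (τ.arr 8 0 x)) with hφ
    have f2 : φ.var 2 = 1 := by simp [hφ, h2]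
    have f6 : φ.var 6 = x := by simp [hφ, h6]
    have hag := agreeOff_run testReady φ
    have hr := run_testReady (n := n) (σ := φ) (by simp [hφ, h0]) f2
      (by simp [hφ, h3]) (by simp [hφ, h2])
    rw [f6] at hr
    have hready : (run testReady φ).var 7 = 1 ↔ ∀ y, B y x → y ∈ l := by
      rw [hr]
      exact forall_congr' fun y => imp_congr (hB y x) (h.mem y)
    set ψ := run testReady φ
    have p2 : ψ.var 2 = 1 := by rw [hag.1 2 (by decide), f2]
    have p3 : ψ.var 3 = 0 := by rw [hag.1 3 (by decide)]; simp [hφ, h3]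
    have p6 : ψ.var 6 = x := by rw [hag.1 6 (by decide), f6]
    have hψ : Listed B l ψ := h.congr (by rw [hag.1 9 (by decide)]; simp [hφ])
      (hag.2 3 (by decide)) (hag.2 8 (by decide))
    rw [p2]
    by_cases hc : ψ.var 7 = 1
    · refine ⟨l ++ [x], ?_, List.prefix_append _ _, fun _ => by simp⟩
      rw [if_pos hc]
      have := hψ.append hx (hready.1 hc)
      simpa only [run_store, run_succ, State.setArr_var, p3, p6, p2] using this
    · refine ⟨l, ?_, List.prefix_rfl, fun hy => absurd (hready.2 hy) hc⟩
      rw [if_neg hc]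
      exact hψ

/-- List the vertices in an order that respects the matrix in array `7`. -/
def topSort : Cmd :=
  .seq (.zero 9) (forAll visit)

/-- Each outer round lists at least one vertex as long as some are missing, so `n` rounds list them
all. -/
theorem run_topSort {B : Fin n → Fin n → Prop} {σ : State} (h0 : σ.var 0 = n) (h2 : σ.var 2 = 1)
    (h3 : σ.var 3 = 0) (hB : ∀ y x : Fin n, σ.arr 7 y x = 1 ↔ B y x)
    (h8 : ∀ x : Fin n, σ.arr 8 0 x = 0)
    (hready : ∀ D : Set (Fin n), (∃ x, x ∉ D) → ∃ x, x ∉ D ∧ ∀ y, B y x → y ∈ D) :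
    ∃ l, Listed B l (run topSort σ) ∧ ∀ x, x ∈ l := by
  have hinit : Listed B [] (σ.setVar 9 0) :=
    ⟨by simp, by simp, by simp [h8], by simp, by simp, by simp⟩
  have main := run_loop_induction (x := 5) (y := 0) (c := .loop 6 0 visit) (σ := σ.setVar 9 0)
    (fun k υ => ∃ l, Listed B l υ ∧ ((∀ x, x ∈ l) ∨ k ≤ l.length)) ⟨[], hinit, by simp⟩ (by
    rintro k υ hk hυ ⟨l, hl, hlk⟩
    have hυ' := hυ.setVar (x := 5) (v := k) List.mem_cons_self
    have e0 : (υ.setVar 5 k).var 0 = n := by rw [hυ'.1 0 (by decide)]; simp [h0]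
    have inner := run_loop_induction (x := 6) (y := 0) (c := visit) (σ := υ.setVar 5 k)
      (fun m φ => ∃ l', Listed B l' φ ∧ l <+: l' ∧
        ∀ x : Fin n, (x : ℕ) < m → (∀ y, B y x → y ∈ l) → x ∈ l')
      ⟨l, hl.congr (by simp) rfl rfl, List.prefix_rfl, by simp⟩ (by
      rintro m φ hm hφ ⟨l', hl', hpre, hmem⟩
      rw [e0] at hm
      have hφ' := hφ.setVar (x := 6) (v := m) List.mem_cons_self
      have e7 : (φ.setVar 6 m).arr 7 = σ.arr 7 := by
        rw [hφ'.2 7 (by decide), hυ'.2 7 (by decide)]; rfl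
      obtain ⟨l'', hl'', hpre', hx⟩ := Listed.run_visit (x := ⟨m, hm⟩)
        (hl'.congr (τ := φ.setVar 6 m) (by simp) rfl rfl)
        (by rw [hφ'.1 0 (by decide), e0])
        (by rw [hφ'.1 2 (by decide), hυ'.1 2 (by decide)]; simp [h2])
        (by rw [hφ'.1 3 (by decide), hυ'.1 3 (by decide)]; simp [h3])
        (by rw [e7]; exact hB) (by simp)
      refine ⟨l'', hl'', hpre.trans hpre', fun x hxm hr => ?_⟩
      rcases Nat.lt_succ_iff_lt_or_eq.1 hxm with hxm | hxm
      · exact hpre'.subset (hmem x hxm hr)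
      · obtain rfl : x = ⟨m, hm⟩ := Fin.ext hxm
        exact hx fun y hy => hpre.subset (hr y hy))
    rw [e0] at inner
    obtain ⟨l', hl', hpre, hmem⟩ := inner
    refine ⟨l', hl', ?_⟩
    by_cases hall : ∀ x, x ∈ l
    · exact Or.inl fun x => hpre.subset (hall x)
    -- A vertex that is ready at the start of the round stays ready, so it is listed by the time its
    -- turn is over.
    · obtain ⟨x, hx, hxr⟩ := hready {x | x ∈ l} (by simpa using hall)
      have hx' := hmem x x.2 hxr
      have hne : l ≠ l' := by rintro rfl; exact hx hx'
      have hlen : l.length < l'.length :=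
        lt_of_le_of_ne hpre.length_le fun e => hne (hpre.eq_of_length e)
      rcases hlk with h | h
      · exact absurd h hall
      · exact Or.inr (by omega))
  have e0 : (σ.setVar 9 0).var 0 = n := by simp [h0]
  rw [e0] at main
  obtain ⟨l, hl, hlk⟩ := main
  refine ⟨l, hl, ?_⟩
  rcases hlk with h | h
  · exact h
  · have hcard : l.toFinset = Finset.univ := by
      rw [← Finset.card_eq_iff_eq_univ, Fintype.card_fin, List.toFinset_card_of_nodup hl.nodup]
      refine le_antisymm ?_ h
      simpa using hl.nodup.length_le_card
    intro x
    rw [← List.mem_toFinset, hcard]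
    exact Finset.mem_univ x

/-! ### The program -/

def transposeEntry : Cmd :=
  .seq (.load 4 0 6 5) (.store 5 5 6 4)

/-- Seeds row `w` with `s` alone, or with nothing if `w = s`. Closing the rows under the arcs of `G`
then yields the vertices not dominated by `w`. -/
def avoidEntry : Cmd :=
  .ifEq 6 1 (.ifEq 5 1 (.store 4 5 6 3) (.store 4 5 6 2)) (.store 4 5 6 3)

/-- Seeds row `w` with the tails of arcs into `w` that `w` dominates, or with all other vertices if
`w = s`. Closing under the transposed arcs yields the loops. -/
def loopEntry : Cmd :=
  .ifEq 6 5 (.store 6 5 6 3) (.ifEq 5 1 (.store 6 5 6 2)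
    (.seq (.load 4 0 6 5) (.ifEq 4 2
      (.seq (.load 4 4 5 6) (.ifEq 4 2 (.store 6 5 6 3) (.store 6 5 6 2)))
      (.store 6 5 6 3))))

/-- Variables `10` and `4` first hold the colours of the two vertices, with 1 for the right part;
variable `4` is then reused for the entry of the matrix. -/
def precedesEntry : Cmd :=
  .seq (.load 10 2 3 5) (.seq (.load 4 2 3 6) (.seq
    (.ifEq 10 2 (.ifEq 4 2 (.load 4 0 5 6) (.copy 4 2)) (.ifEq 4 2 (.zero 4) (.load 4 0 6 5)))
    (.store 7 5 6 4)))

theorem run_transpose (σ : State) : ∀ i j, i < σ.var 0 → j < σ.var 0 →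
    (run (forAll transposeEntry) σ).arr 5 i j = σ.arr 0 j i := by
  refine run_forAll _ (by decide) ?_
  rintro τ i j - - hτ rfl rfl k l
  simp [transposeEntry, ← hτ.2 0 (by decide)]

theorem run_avoid (σ : State) (h2 : σ.var 2 = 1) (h3 : σ.var 3 = 0) :
    ∀ i j, i < σ.var 0 → j < σ.var 0 → (run (forAll avoidEntry) σ).arr 4 i j =
      if j = σ.var 1 ∧ i ≠ σ.var 1 then 1 else 0 := by
  refine run_forAll _ (by decide) ?_
  rintro τ i j - - hτ rfl rfl k l
  rw [← hτ.1 1 (by decide)]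
  rw [← hτ.1 2 (by decide)] at h2
  rw [← hτ.1 3 (by decide)] at h3
  by_cases c1 : τ.var 6 = τ.var 1 <;> by_cases c2 : τ.var 5 = τ.var 1 <;>
    simp [avoidEntry, c1, c2, h2, h3]

theorem run_loopEntry (σ : State) (h2 : σ.var 2 = 1) (h3 : σ.var 3 = 0) :
    ∀ i j, i < σ.var 0 → j < σ.var 0 → (run (forAll loopEntry) σ).arr 6 i j =
      if j ≠ i ∧ (i = σ.var 1 ∨ σ.arr 0 j i = 1 ∧ σ.arr 4 i j ≠ 1) then 1 else 0 := by
  refine run_forAll _ (by decide) ?_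
  rintro τ i j - - hτ rfl rfl k l
  rw [← hτ.1 1 (by decide), ← hτ.2 0 (by decide), ← hτ.2 4 (by decide)]
  rw [← hτ.1 2 (by decide)] at h2
  rw [← hτ.1 3 (by decide)] at h3
  by_cases c1 : τ.var 6 = τ.var 5 <;> by_cases c2 : τ.var 5 = τ.var 1 <;>
    by_cases c3 : τ.arr 0 (τ.var 6) (τ.var 5) = 1 <;>
    by_cases c4 : τ.arr 4 (τ.var 5) (τ.var 6) = 1 <;>
    simp_all [loopEntry]

theorem run_precedes (σ : State) (h2 : σ.var 2 = 1) (h3 : σ.var 3 = 0) :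
    ∀ i j, i < σ.var 0 → j < σ.var 0 → (run (forAll precedesEntry) σ).arr 7 i j =
      if σ.arr 2 0 i = 1 then (if σ.arr 2 0 j = 1 then σ.arr 0 i j else 1)
      else if σ.arr 2 0 j = 1 then 0 else σ.arr 0 j i := by
  refine run_forAll _ (by decide) ?_
  rintro τ i j - - hτ rfl rfl k l
  rw [← hτ.2 0 (by decide), ← hτ.2 2 (by decide)]
  rw [← hτ.1 2 (by decide)] at h2
  rw [← hτ.1 3 (by decide)] at h3
  by_cases c1 : τ.arr 2 0 (τ.var 5) = 1 <;> by_cases c2 : τ.arr 2 0 (τ.var 6) = 1 <;>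
    simp [precedesEntry, c1, c2, h2, h3]

/-- The program: it computes the transposed adjacency matrix (array `5`), the non-dominance
relation (`4`), the natural loops (`6`), the innermost loops (`1`), the parities of the nesting
depths (`2`), the precedence relation of the LR-order (`7`), and the LR-order (`3`). -/
def lrProgram : Cmd :=
  -- Variable `3` is never written and serves as the constant 0; the first command makes variable
  -- `2` the constant 1.
  .seq (.succ 2 3) (.seq (forAll transposeEntry) (.seq (forAll avoidEntry) (.seq (closeRows 0 4)
    (.seq (forAll loopEntry) (.seq (closeRows 5 6) (.seq computeHeads
      (.seq (forAll precedesEntry) topSort)))))))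

/-- Restates loops as backward reachability from seeds, in the form computed by `closeRows`. -/
theorem inLoop_iff {G : Digraph (Fin n)} {s : Fin n} (w v : Fin n) : G.InLoop s w v ↔
    ∃ a, (a ≠ w ∧ (w = s ∨ G.Adj a w ∧ ¬ G.ReachAvoid s w a)) ∧
      Relation.ReflTransGen (fun a b => G.Adj b a ∧ b ≠ w) a v := by
  constructor
  · rintro ⟨hv, h | ⟨z, hz, hd, hp⟩⟩
    · exact ⟨v, ⟨hv, Or.inl h⟩, .refl⟩
    · induction hp using Relation.ReflTransGen.head_induction_on with
      | refl => exact ⟨z, ⟨hv, Or.inr ⟨hz, hd⟩⟩, .refl⟩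
      | head hab _ ih =>
        obtain ⟨a, ha, hp⟩ := ih hab.2.2
        exact ⟨a, ha, hp.tail ⟨hab.1, hv⟩⟩
  · rintro ⟨a, ⟨ha, h⟩, hp⟩
    induction hp with
    | refl => exact ⟨ha, h.imp_right fun h => ⟨a, h.1, h.2, .refl⟩⟩
    | tail _ hbc ih => exact ih.of_adj hbc.1 hbc.2

/-- The stages are composed by giving each one its mathematical meaning, then carrying the facts
still needed across the next stage by the frame rule and forgetting how the memory arose. -/
theorem run_lrProgram {G : Digraph (Fin n)} {s : Fin n} (hG : G.IsReducible s) :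
    (∀ v : Fin n, ∃ h : Fin n, (run lrProgram (input G s)).arr 1 0 v = h ∧
      (v ≠ s → G.IsInnermost s h v)) ∧
    (∀ v : Fin n, (run lrProgram (input G s)).arr 2 0 v = {u | G.InLoop s u v}.ncard % 2) ∧
    ∃ U, HoldsSeq (run lrProgram (input G s)) 3 U ∧ IsVertexOrder U ∧
      U.Pairwise fun a b => ¬ G.Precedes {v | Odd {u | G.InLoop s u v}.ncard} b a := by
  obtain ⟨T⟩ := nonempty_dfst G s
  have hR := isHeadColoring_odd hG.1 T
  set R : Set (Fin n) := {v | Odd {u | G.InLoop s u v}.ncard} with hRdef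
  have hadj : ∀ a b : Fin n, (input G s).arr 0 a b = 1 ↔ G.Adj a b := by
    intro a b; simp [input]
  simp only [lrProgram, run_seq]
  set σ₁ := run (.succ 2 3) (input G s) with hσ₁
  have v0 : σ₁.var 0 = n := by simp [hσ₁, input]
  have v1 : σ₁.var 1 = s := by simp [hσ₁, input]
  have v2 : σ₁.var 2 = 1 := by simp [hσ₁, input]
  have v3 : σ₁.var 3 = 0 := by simp [hσ₁, input]
  have a0 : σ₁.arr 0 = (input G s).arr 0 := rfl
  have a8 : ∀ x : Fin n, σ₁.arr 8 0 x = 0 := by intro x; simp [hσ₁, input]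
  clear_value σ₁
  have t := run_transpose σ₁
  have ag := agreeOff_run (forAll transposeEntry) σ₁
  set σ₂ := run (forAll transposeEntry) σ₁
  rw [a0, v0] at t
  rw [← ag.1 0 (by decide)] at v0
  rw [← ag.1 1 (by decide)] at v1
  rw [← ag.1 2 (by decide)] at v2
  rw [← ag.1 3 (by decide)] at v3
  rw [← ag.2 0 (by decide)] at a0
  rw [← ag.2 8 (by decide)] at a8
  clear_value σ₂; clear ag
  have av := run_avoid σ₂ v2 v3
  have ag := agreeOff_run (forAll avoidEntry) σ₂
  set σ₃ := run (forAll avoidEntry) σ₂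
  rw [v0, v1] at av
  rw [← ag.1 0 (by decide)] at v0
  rw [← ag.1 1 (by decide)] at v1
  rw [← ag.1 2 (by decide)] at v2
  rw [← ag.1 3 (by decide)] at v3
  rw [← ag.2 0 (by decide)] at a0
  rw [← ag.2 5 (by decide)] at t
  rw [← ag.2 8 (by decide)] at a8
  clear_value σ₃; clear ag
  have rc := run_closeRows (E := 0) (X := 4) (by decide) v0 v2
  have ag := agreeOff_run (closeRows 0 4) σ₃
  set σ₄ := run (closeRows 0 4) σ₃
  have ra : ∀ w v : Fin n, σ₄.arr 4 w v = 1 ↔ G.ReachAvoid s w v := by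
    intro w v
    rw [rc]
    simp only [a0, hadj]
    constructor
    · rintro ⟨a, ha, h⟩
      rw [av _ _ w.2 a.2] at ha
      split at ha
      · next h' =>
        obtain rfl : a = s := Fin.ext h'.1
        exact ⟨fun e => h'.2 (by rw [e]), h⟩
      · exact absurd ha (by simp)
    · rintro ⟨h1, h2⟩
      refine ⟨s, ?_, h2⟩
      rw [av _ _ w.2 s.2, if_pos ⟨rfl, fun e => h1 (Fin.ext e).symm⟩]
  rw [← ag.1 0 (by decide)] at v0
  rw [← ag.1 1 (by decide)] at v1
  rw [← ag.1 2 (by decide)] at v2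
  rw [← ag.1 3 (by decide)] at v3
  rw [← ag.2 0 (by decide)] at a0
  rw [← ag.2 5 (by decide)] at t
  rw [← ag.2 8 (by decide)] at a8
  clear_value σ₄; clear ag rc av
  have li := run_loopEntry σ₄ v2 v3
  have ag := agreeOff_run (forAll loopEntry) σ₄
  set σ₅ := run (forAll loopEntry) σ₄
  have li' : ∀ w a : Fin n, σ₅.arr 6 w a = 1 ↔
      a ≠ w ∧ (w = s ∨ G.Adj a w ∧ ¬ G.ReachAvoid s w a) := by
    intro w a
    rw [li _ _ (by rw [v0]; exact w.2) (by rw [v0]; exact a.2), a0, v1, ← hadj, ← ra w a]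
    simp only [Fin.val_inj, ne_eq]
    split <;> simp_all
  rw [← ag.1 0 (by decide)] at v0
  rw [← ag.1 1 (by decide)] at v1
  rw [← ag.1 2 (by decide)] at v2
  rw [← ag.1 3 (by decide)] at v3
  rw [← ag.2 0 (by decide)] at a0
  rw [← ag.2 5 (by decide)] at t
  rw [← ag.2 8 (by decide)] at a8
  clear_value σ₅; clear ag li ra
  have rc := run_closeRows (E := 5) (X := 6) (by decide) v0 v2
  have ag := agreeOff_run (closeRows 5 6) σ₅
  set σ₆ := run (closeRows 5 6) σ₅
  have hl : ∀ w v : Fin n, σ₆.arr 6 w v = 1 ↔ G.InLoop s w v := by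
    intro w v
    have ht : ∀ a b : Fin n, σ₅.arr 5 a b = 1 ↔ G.Adj b a := fun a b => by
      rw [t _ _ a.2 b.2, hadj]
    rw [rc, inLoop_iff]
    simp only [li', ht]
  rw [← ag.1 0 (by decide)] at v0
  rw [← ag.1 1 (by decide)] at v1
  rw [← ag.1 2 (by decide)] at v2
  rw [← ag.1 3 (by decide)] at v3
  rw [← ag.2 0 (by decide)] at a0
  rw [← ag.2 8 (by decide)] at a8
  clear_value σ₆; clear ag rc li' t
  have hh := run_computeHeads hG.1 T v0 v1 v2 v3 hl
  have ag := agreeOff_run computeHeads σ₆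
  set σ₇ := run computeHeads σ₆
  rw [← ag.1 0 (by decide)] at v0
  rw [← ag.1 2 (by decide)] at v2
  rw [← ag.1 3 (by decide)] at v3
  rw [← ag.2 0 (by decide)] at a0
  rw [← ag.2 8 (by decide)] at a8
  clear_value σ₇; clear ag hl v1
  have hp := run_precedes σ₇ v2 v3
  have ag := agreeOff_run (forAll precedesEntry) σ₇
  set σ₈ := run (forAll precedesEntry) σ₇
  have hRm : ∀ v : Fin n, σ₇.arr 2 0 v = 1 ↔ v ∈ R := by
    intro v
    rw [(hh v).2, hRdef, Set.mem_ofPred_eq, Nat.odd_iff]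
  have hp' : ∀ y x : Fin n, σ₈.arr 7 y x = 1 ↔ G.Precedes R y x := by
    intro y x
    rw [hp _ _ (by rw [v0]; exact y.2) (by rw [v0]; exact x.2)]
    simp only [hRm, a0]
    unfold Digraph.Precedes
    rw [← hadj, ← hadj]
    by_cases c1 : y ∈ R <;> by_cases c2 : x ∈ R <;> simp [c1, c2]
  rw [← ag.1 0 (by decide)] at v0
  rw [← ag.1 2 (by decide)] at v2
  rw [← ag.1 3 (by decide)] at v3
  rw [← ag.2 1 (by decide), ← ag.2 2 (by decide)] at hh
  rw [← ag.2 8 (by decide)] at a8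
  clear_value σ₈; clear ag hp hRm a0
  obtain ⟨U, hU, hall⟩ := run_topSort v0 v2 v3 hp' a8 fun D => hR.exists_ready hG
  have ag := agreeOff_run topSort σ₈
  rw [← ag.2 1 (by decide), ← ag.2 2 (by decide)] at hh
  exact ⟨fun v => (hh v).1, fun v => (hh v).2, U, hU.seq, ⟨hU.nodup, hall⟩, hU.pairwise⟩

end Ram

/-! ### The polynomial-time statement and the main theorem. -/

namespace Digraph

theorem exists_lrProgram : ∃ (prog : Ram.Cmd) (p : Polynomial ℕ),
    ∀ (n : ℕ) (G : Digraph (Fin n)) (s : Fin n), G.IsReducible s →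
      (Ram.exec prog (Ram.input G s)).2 ≤ p.eval n ∧
      ∃ (h : Fin n → Fin n) (R L : Set (Fin n)) (U : List (Fin n)),
        (∀ v, v ≠ s → Ram.State.arr (Ram.exec prog (Ram.input G s)).1 1 0 v = h v) ∧
        Ram.HoldsSet (Ram.exec prog (Ram.input G s)).1 2 R ∧
        Ram.HoldsSeq (Ram.exec prog (Ram.input G s)).1 3 U ∧
        (∀ T : Digraph.DFST G s,
          (∀ v, v ≠ s → h v ∈ T.W ∧ v ∈ T.pStar (h v)) ∧ T.LROutput R L U) ∧
        G.IsLROrder U ∧ G.IsAcyclicFVS R ∧ G.AcyclicOn L := by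
  refine ⟨Ram.lrProgram, Ram.lrProgram.cost, fun n G s hG => ⟨?_, ?_⟩⟩
  -- All loops run up to variable `0`, which holds `n` and is never written.
  · refine (Ram.exec_time_le 0 Ram.lrProgram (by decide) ?_ _).trans_eq rfl
    simp [Ram.lrProgram, Ram.forAll, Ram.transposeEntry, Ram.avoidEntry, Ram.closeRows, Ram.relax,
      Ram.whenArr, Ram.unlessArr, Ram.loopEntry, Ram.computeHeads, Ram.headStep,
      Ram.precedesEntry, Ram.topSort, Ram.visit, Ram.testReady, Ram.Cmd.LoopsTo]
  · obtain ⟨T₀⟩ := nonempty_dfst G s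
    have hR := isHeadColoring_odd hG.1 T₀
    obtain ⟨hh, hc, U, hseq, hU, hpw⟩ := Ram.run_lrProgram hG
    have hrun : (Ram.exec Ram.lrProgram (Ram.input G s)).1 =
      Ram.run Ram.lrProgram (Ram.input G s) := by rw [Ram.run]
    rw [hrun]
    generalize Ram.run Ram.lrProgram (Ram.input G s) = τ at hh hc hseq
    -- The value of `h` at `s` carries no meaning, as `s` lies in no loop.
    choose h hh hin using hh
    refine ⟨h, _, _, U, fun v _ => hh v, fun v => ⟨fun hv => ?_, fun hv => ?_⟩, hseq,
      fun T => ⟨fun v hv => ⟨T.mem_W_of_inLoop hG.1 (hin v hv).1,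
        (T.mem_pStar hG _ v).2 (hin v hv)⟩, ?_⟩,
      (isStandardLROrder_of_pairwise hG.1.1 hU hpw).isLROrder,
      hR.isAcyclicFVS hG fun e => root_notMem_odd hG.1 T₀ ?_, hR.right.acyclicOn hG⟩
    · exact (hc v).trans (Nat.odd_iff.1 hv)
    · exact (hc v).trans (Nat.not_odd_iff.1 hv)
    -- The program sorts once for both parts; the two topological orders demanded by the algorithm
    -- are recovered from its list.
    · obtain ⟨l, l', hl, hl', rfl⟩ := exists_isTopOrder_append_of_pairwise hG.1.1 hU hpw
      exact T.lrOutput_of_isTopOrder hG hR hl hl'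
    · rw [e]; trivial

end Digraph

theorem mainTheorem4 :
    -- Every reducible flow graph: the algorithm produces a result, for any spanning tree, and
    -- every result that it can produce is a (standard) LR-order.
    (∀ (V : Type*) [Fintype V] [DecidableEq V] (G : Digraph V) (s : V), G.IsReducible s →
      ∀ T : Digraph.DFST G s,
        (∃ R L U, T.LROutput R L U) ∧
        ∀ R L U, T.LROutput R L U →
          G.IsLROrder U ∧ G.IsStandardLROrder R L U ∧
          G.AcyclicOn R ∧ G.AcyclicOn L ∧
          (Nontrivial V → G.IsAcyclicFVS R ∧ G.IsAcyclicFVS L)) ∧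
    -- Every reducible flow graph has an acyclic feedback vertex set.
    (∀ (V : Type*) [Fintype V] [DecidableEq V] (G : Digraph V) (s : V), G.IsReducible s →
      ∃ S : Set V, G.IsAcyclicFVS S ∧ G.AcyclicOn Sᶜ) ∧
    -- The algorithm runs in polynomial time: one program, on input `(G, s)`, computes the sets
    -- `P*(w)` (array 1), the set `R` (array 2) and the LR-order `U` (array 3).
    (∃ (prog : Ram.Cmd) (p : Polynomial ℕ),
      ∀ (n : ℕ) (G : Digraph (Fin n)) (s : Fin n), G.IsReducible s →
        (Ram.exec prog (Ram.input G s)).2 ≤ p.eval n ∧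
        ∃ (h : Fin n → Fin n) (R L : Set (Fin n)) (U : List (Fin n)),
          (∀ v, v ≠ s → Ram.State.arr (Ram.exec prog (Ram.input G s)).1 1 0 v = h v) ∧
          Ram.HoldsSet (Ram.exec prog (Ram.input G s)).1 2 R ∧
          Ram.HoldsSeq (Ram.exec prog (Ram.input G s)).1 3 U ∧
          (∀ T : Digraph.DFST G s,
            (∀ v, v ≠ s → h v ∈ T.W ∧ v ∈ T.pStar (h v)) ∧ T.LROutput R L U) ∧
          G.IsLROrder U ∧ G.IsAcyclicFVS R ∧ G.AcyclicOn L) := by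
  exact ⟨fun _ _ _ _ _ hG T => hG.lr_ordering T, fun _ _ _ _ _ hG => hG.exists_isAcyclicFVS,
    Digraph.exists_lrProgram⟩
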